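/- Let $N\ge 1$ be an integer and $p>p_S$, where $p_S=\frac{N+2}{N-2}$ if $N>2$ and $p_S=\infty$ if $N\le 2$. Consider the equation $$w_{rr}+\Bigl(\frac{N-1}r-\frac r2\Bigr)w_r-\frac{w}{p-1}+|w|^{p-1}w=0 \tag{1}$$ on intervals in $(0,\infty)$. For $\alpha>0$ let $w(\cdot,\alpha)\in C^1$ be the solution of (1) for $r>0$ with $w(0,\alpha)=\alpha$, $w_r(0,\alpha)=0$, extended to its maximal existence interval, and let $\mathcal S$ be the set of all $\alpha>0$ for which $w(\cdot,\alpha)$ is defined and positive on $(0,\infty)$. Set $\kappa=(p-1)^{-1/(p-1)}$, $$L=\Bigl(\frac{2}{(p-1)^2}\bigl((N-2)p-N\bigr)\Bigr)^{1/(p-1)},\qquad \phi_\infty(r)=L\,r^{-2/(p-1)} .$$ For $\alpha\in\mathcal S\setminus\{\kappa\}$ let $\ell(\alpha)\in(0,\infty)$ denote the limit of $r^{2/(p-1)}w(r,\alpha)$ as $r\to\infty$ (it is known that this limit exists and is positive). For $\ell\in\mathbb R$ consider the conditions $$u(r)=\ell r^{-\frac2{p-1}}\bigl(1+o(r^{-1})\bigr),\qquad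 \frac{u'(r)}{u(r)}=-\frac2{p-1}r^{-1}+o(r^{-2})\qquad (r\to\infty). \tag{2}$$ Lemma. Given any $\ell_0\in\{L\}\cup\{\ell(\alpha):\alpha\in\mathcal S\setminus\{\kappa\}\}$ and $r_0\in(0,\infty)$, there are $\theta>0$ and a positive function $u$ on $[r_0/2,\infty)\times(\ell_0-\theta,\ell_0+\theta)$, (jointly) real analytic on $(r_0/2,\infty)\times(\ell_0-\theta,\ell_0+\theta)$, with the following properties. (i) For any $\ell\in(\ell_0-\theta,\ell_0+\theta)$ the function $u(\cdot,\ell)$ is a positive solution of (1) on $[r_0/2,\infty)$ satisfying (2), and it is the only solution of (1) satisfying (2), up to extensions and restrictions: if $R\ge 0$ and $w$ is a solution of (1) on $(R,\infty)$ satisfying (2) with the same $\ell$, then $w(r)=u(r,\ell)$ for all $r>R$ with $r\ge r_0/2$. (ii) The function $u_\ell(\cdot,\ell_0)=\frac{\partial u}{\partial\ell}(\cdot,\ell_0)$ extends from $(r_0/2,\infty)$ to a function $z$ on $(0,\infty)$ which satisfies there the linear equation $$z_{rr}+\Bigl(\frac{N-1}r-\frac r2\Bigr)z_r+\Bigl(-\frac1{p-1}+p\,\phi(r)^{p-1}\Bigr)z=0,$$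 where $\phi=w(\cdot,\alpha_0)$ if $\ell_0=\ell(\alpha_0)$ for some $\alpha_0\in\mathcal S\setminus\{\kappa\}$, and $\phi=\phi_\infty$ if $\ell_0=L$. Moreover, $r^{2/(p-1)}u_\ell(r,\ell_0)\to1$ as $r\to\infty$. -/

import Mathlib

open Set Filter Topology Asymptotics

noncomputable section

/-- The Sobolev exponent: `(N+2)/(N-2)` if `N > 2`, and `∞` if `N ≤ 2`. -/
def pS (N : ℕ) : EReal :=
  if 2 < N then ((((N : ℝ) + 2) / ((N : ℝ) - 2) : ℝ) : EReal) else ⊤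

/-- The constant solution `κ = (p-1)^{-1/(p-1)}`. -/
def kappa (p : ℝ) : ℝ := (p - 1) ^ (-(1 / (p - 1)))

/-- `L = (2/(p-1)² · ((N-2)p - N))^{1/(p-1)}`. -/
def Lconst (N : ℕ) (p : ℝ) : ℝ :=
  (2 / (p - 1) ^ 2 * (((N : ℝ) - 2) * p - N)) ^ (1 / (p - 1))

/-- The singular solution `φ_∞(r) = L r^{-2/(p-1)}` as a function of the radius. -/
def phiInfty (N : ℕ) (p : ℝ) (r : ℝ) : ℝ := Lconst N p * r ^ (-(2 / (p - 1)))

/-- `z_rr + ((N-1)/r - r/2) z_r` at `r`; derivatives are taken within the interval `I`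
(one-sided at an endpoint belonging to `I`, the usual ones in the interior). -/
def radialOp (N : ℕ) (I : Set ℝ) (z : ℝ → ℝ) (r : ℝ) : ℝ :=
  derivWithin (derivWithin z I) I r + (((N : ℝ) - 1) / r - r / 2) * derivWithin z I r

/-- `w` is a `C²` solution on the interval `I` of
`w_rr + ((N-1)/r - r/2) w_r - w/(p-1) + |w|^{p-1} w = 0`
(for `w > 0` the nonlinearity is `w^p`). -/
def IsSolutionOn (N : ℕ) (p : ℝ) (I : Set ℝ) (w : ℝ → ℝ) : Prop :=
  ContDiffOn ℝ 2 w I ∧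
    ∀ r ∈ I, radialOp N I w r - w r / (p - 1) + |w r| ^ (p - 1) * w r = 0

/-- `z` is a `C²` solution on `(0,∞)` of the equation linearized at the positive function `φ`:
`z_rr + ((N-1)/r - r/2) z_r + (-1/(p-1) + p φ^{p-1}) z = 0`. -/
def IsLinearizedSolution (N : ℕ) (p : ℝ) (φ z : ℝ → ℝ) : Prop :=
  ContDiffOn ℝ 2 z (Ioi 0) ∧
    ∀ r ∈ Ioi (0 : ℝ),
      radialOp N (Ioi 0) z r + (-(1 / (p - 1)) + p * φ r ^ (p - 1)) * z r = 0

/-- `w` is `w(·,α)`, and it is global and positive: `w ∈ C¹[0,∞)`, `w(0) = α`, `w_r(0) = 0`,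
`w` solves the equation on `(0,∞)` and `w > 0` there. Values at negative `r` are irrelevant. -/
structure IsPositiveRegularSolution (N : ℕ) (p α : ℝ) (w : ℝ → ℝ) : Prop where
  contDiffOn_one : ContDiffOn ℝ 1 w (Ici 0)
  value_zero : w 0 = α
  deriv_zero : derivWithin w (Ici 0) 0 = 0
  solution : IsSolutionOn N p (Ioi 0) w
  pos : ∀ r ∈ Ioi (0 : ℝ), 0 < w r

/-- The set `𝒮` of all `α > 0` for which `w(·,α)` is (global and) positive on `(0,∞)`. -/
def regularSet (N : ℕ) (p : ℝ) : Set ℝ :=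
  {α | 0 < α ∧ ∃ w, IsPositiveRegularSolution N p α w}

/-- The relation `ℓ = ℓ(α)` for `w = w(·,α)`: `ℓ` is the positive constant with
`w(r) = ℓ r^{-2/(p-1)} (1 + o(1))` as `r → ∞`. Only the leading term, which determines `ℓ`,
is required. -/
def HasLeadingCoeff (p : ℝ) (w : ℝ → ℝ) (ℓ : ℝ) : Prop :=
  0 < ℓ ∧ Tendsto (fun r : ℝ => r ^ (2 / (p - 1)) * w r) atTop (𝓝 ℓ)

/-- The set `{L} ∪ {ℓ(α) : α ∈ 𝒮 \ {κ}}`. -/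
def admissibleSet (N : ℕ) (p : ℝ) : Set ℝ :=
  {Lconst N p} ∪ {ℓ | ∃ α ∈ regularSet N p \ {kappa p}, ∃ w,
    IsPositiveRegularSolution N p α w ∧ HasLeadingCoeff p w ℓ}

/-- The conditions at infinity, as `r → ∞`:
`u(r) = ℓ r^{-2/(p-1)} (1 + o(r⁻¹))` and `u'(r)/u(r) = -(2/(p-1)) r⁻¹ + o(r⁻²)`. -/
def ConditionsAtInfinity (p ℓ : ℝ) (u : ℝ → ℝ) : Prop :=
  (fun r : ℝ => u r - ℓ * r ^ (-(2 / (p - 1)))) =o[atTop]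
      (fun r : ℝ => ℓ * r ^ (-(2 / (p - 1))) * r⁻¹) ∧
    (fun r : ℝ => deriv u r / u r - (-(2 / (p - 1)) * r⁻¹)) =o[atTop]
      (fun r : ℝ => (r ^ 2)⁻¹)

end

/-! Put `m = 2/(p-1)` and `v = r^m w`. The zeroth order term `-w/(p-1)` disappears and (1) becomes
`v'' + (a/r - r/2) v' + h(v)/r² = 0`, with `h` analytic on `(0,∞)`. The integrating factor `W = r^a
e^{-r²/4}` decays so fast that a solution with a limit at infinity must satisfy `v' = W⁻¹ ∫_r^∞ W
s⁻² h(v) ds`. Hence `v = ℓ + T(h∘v)`, where `T` has norm at most `2/R²` on bounded functions on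
`[R,∞)`. Conversely, fixed points are solutions with limit `ℓ`.

Superposition with `h` is analytic near positive constants, so for large `R` the inverse function
theorem (`AnalyticAt.exists_fixedPoint_family`) makes `v` a locally unique fixed point, analytic in
`ℓ` (`exists_solutionFamily_near_infinity`). Local uniqueness also shows that the leading
coefficient alone determines a solution (`SolvesOn.eq_of_tendsto`), while the decay `v - ℓ =
O(r⁻²)`, `v' = O(r⁻³)` gives (2).

The same fixed point theorem yields an analytic local flow of the ODE. Since the solution for `ℓ₀`
is positive on all of `(0,∞)`, the family extends down to any positive radius, with `θ` shrinking as
needed (`IsSolutionFamily.exists_of_global`). Differentiating in `ℓ` gives the linearized equation,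
and differentiating the fixed point equation gives the limit of `r^m u_ℓ`. -/

open scoped BoundedContinuousFunction

/-! ### Analytic superposition operators and fixed points in Banach spaces -/

/-- The superposition operator `h ↦ f ∘ h` of an analytic function is analytic near constants. -/
theorem AnalyticAt.exists_superposition {f : ℝ → ℝ} {c : ℝ} (hf : AnalyticAt ℝ f c) :
    ∃ G : (ℝ →ᵇ ℝ) → (ℝ →ᵇ ℝ), AnalyticAt ℝ G (BoundedContinuousFunction.const ℝ c) ∧
      ∀ᶠ h in 𝓝 (BoundedContinuousFunction.const ℝ c), ∀ x, G h x = f (h x) := by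
  obtain ⟨p, r, hp⟩ := hf
  set c' := BoundedContinuousFunction.const ℝ c with hc'
  -- The Taylor coefficients of `f` at `c`, read in the Banach algebra of bounded continuous
  -- functions, give a series with the same norms and thus the same radius. Evaluation at `x` maps
  -- it to the Taylor series of `f` at `h x`.
  set P : FormalMultilinearSeries ℝ (ℝ →ᵇ ℝ) (ℝ →ᵇ ℝ) :=
    FormalMultilinearSeries.ofScalars (ℝ →ᵇ ℝ) p.coeff with hP
  have hnorm : ∀ n, ‖P n‖ = ‖p n‖ := fun n => by
    rw [hP, FormalMultilinearSeries.ofScalars_norm, p.norm_apply_eq_norm_coef]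
  have hrad : P.radius = p.radius := by simp only [FormalMultilinearSeries.radius, hnorm]
  have hpos : 0 < P.radius := hrad ▸ hp.r_pos.trans_le hp.r_le
  have hPb := P.hasFPowerSeriesOnBall hpos
  refine ⟨fun h => P.sum (h - c'), ?_, ?_⟩
  · have := (hPb.comp_sub c').analyticAt
    simpa using this
  · have hev : ∀ᶠ h in 𝓝 c', h - c' ∈ Metric.eball (0 : ℝ →ᵇ ℝ) r := by
      have : Tendsto (fun h => h - c') (𝓝 c') (𝓝 0) := by
        have : Continuous fun h : ℝ →ᵇ ℝ => h - c' := by fun_prop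
        simpa using this.tendsto c'
      exact this (Metric.eball_mem_nhds _ hp.r_pos)
    filter_upwards [hev] with h hh x
    have h1 : HasSum (fun n => P n fun _ => h - c') (P.sum (h - c')) := by
      have := hPb.hasSum (y := h - c') (Metric.eball_subset_eball (hrad ▸ hp.r_le) hh)
      simpa using this
    have h2 := h1.mapL (BoundedContinuousFunction.evalCLM ℝ x)
    have hx : (h - c') x ∈ Metric.eball (0 : ℝ) r := by
      rw [Metric.mem_eball, edist_zero_right] at hh ⊢
      refine lt_of_le_of_lt ?_ hh
      simpa [enorm_le_iff_norm_le] using BoundedContinuousFunction.norm_coe_le_norm (h - c') x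
    have h3 := hp.hasSum hx
    have h4 : c + (h - c') x = h x := by simp [hc']
    rw [h4] at h3
    refine h2.unique (h3.congr_fun fun n => ?_)
    simp [hP, FormalMultilinearSeries.ofScalars, mul_comm]

/-- The solution `v` of `v = a + T (G v)` near `(T, a) = (0, a₀)` is an analytic function of
`(T, a)`, where `T` ranges over the bounded operators. -/
theorem AnalyticAt.exists_fixedPoint_family {A : Type*} [NormedAddCommGroup A] [NormedSpace ℝ A]
    [CompleteSpace A] {G : A → A} {a₀ : A} (hG : AnalyticAt ℝ G a₀) {U : Set A} (hU : U ∈ 𝓝 a₀) :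
    ∃ V : (A →L[ℝ] A) × A → A, ∃ ε > 0, Metric.ball a₀ ε ⊆ U ∧ ∃ δ > 0,
      ∀ (T : A →L[ℝ] A) (a : A), ‖T‖ < δ → ‖a - a₀‖ < δ →
        AnalyticAt ℝ V (T, a) ∧ V (T, a) ∈ Metric.ball a₀ ε ∧ V (T, a) = a + T (G (V (T, a))) ∧
        ∀ v ∈ Metric.ball a₀ ε, v = a + T (G v) → V (T, a) = v := by
  -- Solving `v = a + T (G v)` means inverting `H`. Keeping `T` as a coordinate makes the inverse
  -- analytic in `T` and `a` together.
  let H : (A →L[ℝ] A) × A → (A →L[ℝ] A) × A := fun x => (x.1, x.2 - x.1 (G x.2))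
  let x₀ : (A →L[ℝ] A) × A := (0, a₀)
  have hGan : ∀ x : (A →L[ℝ] A) × A, AnalyticAt ℝ G x.2 → AnalyticAt ℝ H x := fun x hx => by
    have h1 : AnalyticAt ℝ (fun x : (A →L[ℝ] A) × A => G x.2) x := hx.comp_of_eq analyticAt_snd rfl
    exact analyticAt_fst.prod (analyticAt_snd.sub
        (((ContinuousLinearMap.id ℝ (A →L[ℝ] A)).analyticAt_bilinear _).comp (analyticAt_fst.prod h1)))
  -- The derivative of `H` at `(0, a₀)` is a shear: as `T = 0` there, the derivative of `G` does not
  -- enter, and invertibility needs no condition on `G`.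
  let i : ((A →L[ℝ] A) × A) ≃L[ℝ] ((A →L[ℝ] A) × A) := ContinuousLinearEquiv.equivOfInverse
    ((ContinuousLinearMap.fst ℝ (A →L[ℝ] A) A).prod
      (ContinuousLinearMap.snd ℝ (A →L[ℝ] A) A -
        (ContinuousLinearMap.apply ℝ A (G a₀)).comp (ContinuousLinearMap.fst ℝ (A →L[ℝ] A) A)))
    ((ContinuousLinearMap.fst ℝ (A →L[ℝ] A) A).prod
      (ContinuousLinearMap.snd ℝ (A →L[ℝ] A) A +
        (ContinuousLinearMap.apply ℝ A (G a₀)).comp (ContinuousLinearMap.fst ℝ (A →L[ℝ] A) A)))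
    (fun x => by ext <;> simp) (fun x => by ext <;> simp)
  have hH₀ : AnalyticAt ℝ H x₀ := hGan x₀ hG
  have hstrict : HasStrictFDerivAt H (i : (A →L[ℝ] A) × A →L[ℝ] (A →L[ℝ] A) × A) x₀ := by
    have h0 := hH₀.hasStrictFDerivAt
    have h1 : HasFDerivAt (fun x : (A →L[ℝ] A) × A => G x.2)
        ((fderiv ℝ G a₀).comp (ContinuousLinearMap.snd ℝ (A →L[ℝ] A) A)) x₀ :=
      (hG.differentiableAt.hasFDerivAt).comp x₀ hasFDerivAt_snd
    have h2 : HasFDerivAt H _ x₀ :=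
      hasFDerivAt_fst.prodMk (hasFDerivAt_snd.sub (hasFDerivAt_fst.clm_apply h1))
    have h3 : fderiv ℝ H x₀ = (i : (A →L[ℝ] A) × A →L[ℝ] (A →L[ℝ] A) × A) :=
      h2.fderiv.trans (ContinuousLinearMap.ext fun x => by simp [i, x₀])
    rwa [h3] at h0
  let e := hstrict.toOpenPartialHomeomorph H
  have he : ∀ x, e x = H x := fun x => rfl
  have hsrc : x₀ ∈ e.source := hstrict.mem_toOpenPartialHomeomorph_source
  have hHx₀ : H x₀ = x₀ := by simp [H, x₀]
  have htgt : x₀ ∈ e.target := by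
    have := e.map_source hsrc
    rwa [he, hHx₀] at this
  have hsymm₀ : e.symm x₀ = x₀ := by
    conv_lhs => rw [← hHx₀, ← he]
    exact e.left_inv hsrc
  have hsymm : AnalyticAt ℝ e.symm x₀ := by
    refine e.analyticAt_symm (i := i) htgt ?_ ?_
    · rw [hsymm₀]; exact hH₀
    · rw [hsymm₀]; exact hstrict.hasFDerivAt.fderiv
  have hfst : ∀ x ∈ e.target, (e.symm x).1 = x.1 := fun x hx => by
    have := congrArg Prod.fst (e.right_inv hx)
    rwa [he] at this
  obtain ⟨ε, hε, hεs⟩ := Metric.mem_nhds_iff.1 (e.open_source.mem_nhds hsrc)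
  obtain ⟨ε', hε', hεU⟩ := Metric.mem_nhds_iff.1 hU
  have hball : ∀ᶠ x in 𝓝 x₀, AnalyticAt ℝ e.symm x ∧ x ∈ e.target ∧
      e.symm x ∈ Metric.ball x₀ (min ε ε') := by
    refine hsymm.eventually_analyticAt.and (Filter.Eventually.and (e.open_target.mem_nhds htgt) ?_)
    have := hsymm.continuousAt
    rw [ContinuousAt, hsymm₀] at this
    exact this (Metric.ball_mem_nhds _ (lt_min hε hε'))
  obtain ⟨δ, hδ, hδs⟩ := Metric.eventually_nhds_iff_ball.1 hball
  refine ⟨fun x => (e.symm x).2, min ε ε', lt_min hε hε',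
    (Metric.ball_subset_ball (min_le_right _ _)).trans hεU, min δ ε, lt_min hδ hε,
    fun T a hT ha => ?_⟩
  have hmem : ((T, a) : (A →L[ℝ] A) × A) ∈ Metric.ball x₀ δ := by
    rw [Metric.mem_ball, dist_eq_norm, Prod.norm_def]
    simpa [x₀] using ⟨hT.trans_le (min_le_left _ _), ha.trans_le (min_le_left _ _)⟩
  obtain ⟨h1, h2, h3⟩ := hδs _ hmem
  have h4 := e.right_inv h2
  have h5 := hfst _ h2
  simp only at h5
  refine ⟨analyticAt_snd.comp h1, ?_, ?_, ?_⟩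
  · rw [Metric.mem_ball, dist_eq_norm] at h3 ⊢
    exact (norm_snd_le (e.symm (T, a) - x₀)).trans_lt h3
  · have h6 := congrArg Prod.snd h4
    rw [he] at h6
    simp only [H, h5] at h6
    exact (sub_eq_iff_eq_add.1 h6)
  · intro v hv hva
    -- Uniqueness is injectivity of `H` on the source of the local inverse; `‖T‖ < ε` is needed to
    -- have `(T, v)` in that source.
    have hTv : ((T, v) : (A →L[ℝ] A) × A) ∈ e.source := by
      apply hεs
      rw [Metric.mem_ball, dist_eq_norm] at hv ⊢
      rw [Prod.norm_def, max_lt_iff]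
      exact ⟨by simpa [x₀] using hT.trans_le (min_le_right _ _), hv.trans_le (min_le_left _ _)⟩
    have h7 : e (T, v) = (T, a) := by
      rw [he]
      simp only [H]
      rw [sub_eq_of_eq_add hva]
    have := e.left_inv hTv
    rw [h7] at this
    simp only [this]

/-! ### The first order system and uniqueness for the initial value problem -/

/-- The second derivative prescribed by the radial equation, as a function of radius, value and
first derivative. -/
noncomputable def radialRhs (N : ℕ) (p r x y : ℝ) : ℝ :=
  -(((N : ℝ) - 1) / r - r / 2) * y + x / (p - 1) - |x| ^ (p - 1) * x

/-- `(f, g)` solves the first order system equivalent to the radial equation on `I`. -/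
def SolvesOn (N : ℕ) (p : ℝ) (I : Set ℝ) (f g : ℝ → ℝ) : Prop :=
  ∀ r ∈ I, HasDerivAt f (g r) r ∧ HasDerivAt g (radialRhs N p r (f r) (g r)) r

theorem SolvesOn.mono {N : ℕ} {p : ℝ} {I J : Set ℝ} {f g : ℝ → ℝ} (h : SolvesOn N p I f g)
    (hJ : J ⊆ I) : SolvesOn N p J f g := fun r hr => h r (hJ hr)

theorem SolvesOn.congr {N : ℕ} {p : ℝ} {I : Set ℝ} (hI : IsOpen I) {f g f' g' : ℝ → ℝ}
    (h : SolvesOn N p I f g) (hf : EqOn f' f I) (hg : EqOn g' g I) : SolvesOn N p I f' g' := by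
  intro r hr
  have hn := hI.mem_nhds hr
  rw [hf hr, hg hr]
  exact ⟨(h r hr).1.congr_of_eventuallyEq (eventually_of_mem hn hf),
    (h r hr).2.congr_of_eventuallyEq (eventually_of_mem hn hg)⟩

/-- At `0` the difference quotient is `|y|^(p-1)`, which tends to `0` because `p > 1`. The
nonlinearity is therefore differentiable on all of `ℝ`, and initial value uniqueness also covers
solutions that change sign, such as the competitors in (i). -/
theorem hasDerivAt_abs_rpow_mul_self {p : ℝ} (hp : 1 < p) (x : ℝ) :
    HasDerivAt (fun x : ℝ => |x| ^ (p - 1) * x) (p * |x| ^ (p - 1)) x := by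
  rcases lt_trichotomy x 0 with hx | rfl | hx
  · have h1 : HasDerivAt (fun x : ℝ => -(-x) ^ p) (p * |x| ^ (p - 1)) x := by
      have := ((hasDerivAt_id x).neg.rpow_const (p := p) (Or.inl (by simpa using hx.ne))).neg
      refine this.congr_deriv ?_
      simp [abs_of_neg hx]
    refine h1.congr_of_eventuallyEq ?_
    filter_upwards [Iio_mem_nhds hx] with y (hy : y < 0)
    have : 0 < -y := by linarith
    have hy' := hy.ne
    rw [abs_of_neg hy, Real.rpow_sub_one this.ne']
    field_simp
  · have hp0 : p - 1 ≠ 0 := by linarith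
    have h0 : (0 : ℝ) < p - 1 := by linarith
    rw [hasDerivAt_iff_tendsto_slope]
    have h1 : Tendsto (fun y : ℝ => |y| ^ (p - 1)) (𝓝[≠] 0) (𝓝 (p * |(0 : ℝ)| ^ (p - 1))) := by
      have hc : Continuous fun y : ℝ => |y| ^ (p - 1) :=
        continuous_abs.rpow_const fun _ => Or.inr h0.le
      have := hc.tendsto 0
      simp only [abs_zero, Real.zero_rpow hp0, mul_zero] at this ⊢
      exact this.mono_left nhdsWithin_le_nhds
    refine h1.congr' ?_
    filter_upwards [self_mem_nhdsWithin] with y (hy : y ≠ 0)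
    simp [slope_def_field, hy]
  · have h1 : HasDerivAt (fun x : ℝ => x ^ p) (p * |x| ^ (p - 1)) x := by
      rw [abs_of_pos hx]
      exact Real.hasDerivAt_rpow_const (Or.inl hx.ne')
    refine h1.congr_of_eventuallyEq ?_
    filter_upwards [Ioi_mem_nhds hx] with y (hy : 0 < y)
    rw [abs_of_pos hy, Real.rpow_sub_one hy.ne']
    field_simp

theorem abs_abs_rpow_mul_self_sub_le {p M x y : ℝ} (hp : 1 < p) (hx : |x| ≤ M) (hy : |y| ≤ M) :
    |(|x| ^ (p - 1) * x) - |y| ^ (p - 1) * y| ≤ p * M ^ (p - 1) * |x - y| := by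
  have := Convex.norm_image_sub_le_of_norm_hasDerivWithin_le (s := Icc (-M) M)
    (f := fun x : ℝ => |x| ^ (p - 1) * x) (f' := fun x => p * |x| ^ (p - 1))
    (C := p * M ^ (p - 1)) (x := y) (y := x)
    (fun z _ => (hasDerivAt_abs_rpow_mul_self hp z).hasDerivWithinAt) (fun z hz => by
      have h1 : 0 ≤ |z| ^ (p - 1) := Real.rpow_nonneg (abs_nonneg z) _
      rw [Real.norm_of_nonneg (by positivity)]
      exact mul_le_mul_of_nonneg_left
        (Real.rpow_le_rpow (abs_nonneg z) (abs_le.2 hz) (by linarith)) (by linarith))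
    (convex_Icc _ _) (abs_le.1 hy) (abs_le.1 hx)
  simpa [Real.norm_eq_abs] using this

/-- On a compact subinterval `[a', b']` containing both radii, `f₁` and `f₂` are bounded by some
`M`, and the drift coefficient is bounded because `a' > 0`. The vector field is then Lipschitz on
the strip `|x| ≤ M`, uniformly in the radius. -/
theorem SolvesOn.eqOn_Ioo {N : ℕ} {p a b c : ℝ} {f₁ g₁ f₂ g₂ : ℝ → ℝ} (hp : 1 < p) (ha : 0 ≤ a)
    (h₁ : SolvesOn N p (Ioo a b) f₁ g₁) (h₂ : SolvesOn N p (Ioo a b) f₂ g₂) (hc : c ∈ Ioo a b)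
    (hf : f₁ c = f₂ c) (hg : g₁ c = g₂ c) {r : ℝ} (hr : r ∈ Ioo a b) :
    f₁ r = f₂ r ∧ g₁ r = g₂ r := by
  obtain ⟨a', ha', hac⟩ := exists_between (lt_min hc.1 hr.1)
  obtain ⟨b', hcb, hb'⟩ := exists_between (max_lt hc.2 hr.2)
  rw [lt_min_iff] at hac
  rw [max_lt_iff] at hcb
  have ha0 : 0 < a' := ha.trans_lt ha'
  have hsub : Icc a' b' ⊆ Ioo a b := fun t ht => ⟨ha'.trans_le ht.1, ht.2.trans_lt hb'⟩
  have hcont : ∀ {f g : ℝ → ℝ}, SolvesOn N p (Ioo a b) f g → ContinuousOn f (Icc a' b') :=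
    fun h t ht => (h t (hsub ht)).1.continuousAt.continuousWithinAt
  obtain ⟨M₁, hM₁⟩ := isCompact_Icc.exists_bound_of_continuousOn (hcont h₁)
  obtain ⟨M₂, hM₂⟩ := isCompact_Icc.exists_bound_of_continuousOn (hcont h₂)
  obtain ⟨B, hB⟩ := isCompact_Icc.exists_bound_of_continuousOn
    (f := fun t : ℝ => -(((N : ℝ) - 1) / t - t / 2)) (s := Icc a' b') (by
      refine ContinuousOn.neg (ContinuousOn.sub (continuousOn_const.div continuousOn_id
        fun t ht => (ha0.trans_le ht.1).ne') (by fun_prop)))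
  set M := max M₁ M₂
  have hB0 : 0 ≤ B := (norm_nonneg _).trans (hB a' ⟨le_rfl, (hac.1.trans hcb.1).le⟩)
  have hM0 : 0 ≤ M := ((norm_nonneg _).trans (hM₁ a' ⟨le_rfl, (hac.1.trans hcb.1).le⟩)).trans
    (le_max_left _ _)
  have hp0 : 0 < p - 1 := by linarith
  have hK0 : 0 ≤ 1 + B + 1 / (p - 1) + p * M ^ (p - 1) := by positivity
  have hlip : ∀ t ∈ Ioo a' b', LipschitzOnWith (1 + B + 1 / (p - 1) + p * M ^ (p - 1)).toNNReal
      (fun x : ℝ × ℝ => ((x.2, radialRhs N p t x.1 x.2) : ℝ × ℝ)) {x : ℝ × ℝ | |x.1| ≤ M} := by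
    intro t ht
    refine LipschitzOnWith.of_dist_le_mul fun x hx y hy => ?_
    have hd1 : |x.1 - y.1| ≤ dist x y := by
      rw [Prod.dist_eq, ← Real.dist_eq]; exact le_max_left _ _
    have hd2 : |x.2 - y.2| ≤ dist x y := by
      rw [Prod.dist_eq, ← Real.dist_eq]; exact le_max_right _ _
    have hd0 : 0 ≤ dist x y := dist_nonneg
    have hBt := hB t (Ioo_subset_Icc_self ht)
    rw [Real.norm_eq_abs] at hBt
    rw [Prod.dist_eq]
    rw [Real.coe_toNNReal _ hK0]
    simp only [Real.dist_eq]
    have h3 := abs_abs_rpow_mul_self_sub_le hp hx hy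
    have hC : 0 ≤ p * M ^ (p - 1) := by positivity
    have hq : 0 ≤ 1 / (p - 1) := by positivity
    refine max_le ?_ ?_
    · refine hd2.trans ?_
      nlinarith [mul_nonneg hB0 hd0, mul_nonneg hC hd0, mul_nonneg hq hd0]
    · have hexp : radialRhs N p t x.1 x.2 - radialRhs N p t y.1 y.2 =
          -(((N : ℝ) - 1) / t - t / 2) * (x.2 - y.2) + 1 / (p - 1) * (x.1 - y.1) -
            ((|x.1| ^ (p - 1) * x.1) - |y.1| ^ (p - 1) * y.1) := by
        simp only [radialRhs]; ring
      rw [hexp]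
      refine (abs_sub _ _).trans ((add_le_add_left (abs_add_le _ _) _).trans ?_)
      rw [abs_mul, abs_mul, abs_of_nonneg hq]
      have e1 := mul_le_mul hBt hd2 (abs_nonneg _) hB0
      have e2 := mul_le_mul_of_nonneg_left hd1 hq
      have e3 := mul_le_mul_of_nonneg_left hd1 hC
      linarith
  have hsol : ∀ {f g : ℝ → ℝ} {M' : ℝ}, SolvesOn N p (Ioo a b) f g → M' ≤ M →
      (∀ t ∈ Icc a' b', ‖f t‖ ≤ M') → ∀ t ∈ Ioo a' b',
      HasDerivAt (fun t => (f t, g t)) (g t, radialRhs N p t (f t) (g t)) t ∧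
        (f t, g t) ∈ {x : ℝ × ℝ | |x.1| ≤ M} := fun h hM' hb t ht =>
    ⟨(h t (hsub (Ioo_subset_Icc_self ht))).1.prodMk (h t (hsub (Ioo_subset_Icc_self ht))).2,
      (hb t (Ioo_subset_Icc_self ht)).trans hM'⟩
  have := ODE_solution_unique_of_mem_Ioo hlip ⟨hac.1, hcb.1⟩ (hsol h₁ (le_max_left _ _) hM₁)
    (hsol h₂ (le_max_right _ _) hM₂) (by simp [hf, hg]) ⟨hac.2, hcb.2⟩
  simpa using this

theorem SolvesOn.eqOn_Ioi {N : ℕ} {p a c : ℝ} {f₁ g₁ f₂ g₂ : ℝ → ℝ} (hp : 1 < p) (ha : 0 ≤ a)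
    (h₁ : SolvesOn N p (Ioi a) f₁ g₁) (h₂ : SolvesOn N p (Ioi a) f₂ g₂) (hc : c ∈ Ioi a)
    (hf : f₁ c = f₂ c) (hg : g₁ c = g₂ c) {r : ℝ} (hr : r ∈ Ioi a) :
    f₁ r = f₂ r ∧ g₁ r = g₂ r :=
  SolvesOn.eqOn_Ioo (b := max c r + 1) hp ha (h₁.mono Ioo_subset_Ioi_self)
    (h₂.mono Ioo_subset_Ioi_self) ⟨hc, by linarith [le_max_left c r]⟩ hf hg
    ⟨hr, by linarith [le_max_right c r]⟩

theorem IsSolutionOn.solvesOn {N : ℕ} {p R : ℝ} {w : ℝ → ℝ} (h : IsSolutionOn N p (Ioi R) w) :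
    SolvesOn N p (Ioi R) w (deriv w) := by
  intro r hr
  have hn : Ioi R ∈ 𝓝 r := isOpen_Ioi.mem_nhds hr
  have hc : ContDiffAt ℝ 2 w r := h.1.contDiffAt hn
  have h1 : HasDerivAt w (deriv w r) r := (hc.differentiableAt (by norm_num)).hasDerivAt
  have h2 : DifferentiableAt ℝ (deriv w) r := by
    have := (hc.derivWithin (m := 1) (by norm_num))
    exact this.differentiableAt (by norm_num)
  refine ⟨h1, h2.hasDerivAt.congr_deriv ?_⟩
  have h3 := h.2 r hr
  have h4 : derivWithin w (Ioi R) =ᶠ[𝓝 r] deriv w :=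
    eventually_of_mem hn fun y hy => derivWithin_of_isOpen isOpen_Ioi hy
  rw [radialOp, derivWithin_of_isOpen isOpen_Ioi hr, derivWithin_of_isOpen isOpen_Ioi hr,
    h4.deriv_eq] at h3
  rw [radialRhs]
  linarith

theorem contDiffOn_two_of_hasDerivAt {I : Set ℝ} {f g k : ℝ → ℝ} (hI : UniqueDiffOn ℝ I)
    (hf : ∀ r ∈ I, HasDerivAt f (g r) r) (hg : ∀ r ∈ I, HasDerivAt g (k r) r)
    (hk : ContinuousOn k I) : ContDiffOn ℝ 2 f I := by
  have key : ∀ {F F' : ℝ → ℝ} {n : ℕ}, (∀ r ∈ I, HasDerivAt F (F' r) r) → ContDiffOn ℝ n F' I →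
      ContDiffOn ℝ (n + 1) F I := fun {F F' n} h h' => by
    rw [contDiffOn_succ_iff_derivWithin hI]
    refine ⟨fun r hr => (h r hr).differentiableAt.differentiableWithinAt, by simp,
      h'.congr fun r hr => ?_⟩
    exact (h r hr).hasDerivWithinAt.derivWithin (hI r hr)
  have h1 : ContDiffOn ℝ ((0 : ℕ) + 1) g I := key hg (by simpa using hk)
  have h2 := key (n := 1) hf (by simpa using h1)
  convert h2 using 1
  norm_num

theorem radialOp_eq_of_hasDerivAt {N : ℕ} {I : Set ℝ} {f g : ℝ → ℝ} {k r : ℝ}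
    (hI : UniqueDiffOn ℝ I) (hf : ∀ r ∈ I, HasDerivAt f (g r) r) (hr : r ∈ I)
    (hg : HasDerivAt g k r) :
    radialOp N I f r = k + (((N : ℝ) - 1) / r - r / 2) * g r := by
  have h1 : EqOn (derivWithin f I) g I := fun t ht =>
    (hf t ht).hasDerivWithinAt.derivWithin (hI t ht)
  rw [radialOp, h1 hr, derivWithin_congr h1 (h1 hr), hg.hasDerivWithinAt.derivWithin (hI r hr)]

theorem SolvesOn.isSolutionOn {N : ℕ} {p : ℝ} (hp : 1 < p) {I : Set ℝ} (hI : UniqueDiffOn ℝ I)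
    (hI0 : I ⊆ Ioi 0) {f g : ℝ → ℝ} (h : SolvesOn N p I f g) : IsSolutionOn N p I f := by
  have hf : ContinuousOn f I := fun r hr => (h r hr).1.continuousAt.continuousWithinAt
  have hg : ContinuousOn g I := fun r hr => (h r hr).2.continuousAt.continuousWithinAt
  have hk : ContinuousOn (fun r => radialRhs N p r (f r) (g r)) I := by
    unfold radialRhs
    refine ((ContinuousOn.mul (ContinuousOn.neg ((continuousOn_const.div continuousOn_id
      fun r hr => (hI0 hr).ne').sub (by fun_prop))) hg).add (hf.div_const _)).sub
      ((hf.abs.rpow_const fun _ _ => Or.inr (by linarith)).mul hf)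
  refine ⟨contDiffOn_two_of_hasDerivAt hI (fun r hr => (h r hr).1) (fun r hr => (h r hr).2) hk,
    fun r hr => ?_⟩
  rw [radialOp_eq_of_hasDerivAt hI (fun r hr => (h r hr).1) hr (h r hr).2, radialRhs]
  ring

/-! ### Analytic local flows -/

section Flow

variable {E : Type*} [NormedAddCommGroup E] [NormedSpace ℝ E]

theorem norm_integral_zero_clamp_le (f : ℝ →ᵇ E) (s : ℝ) :
    ‖∫ x in (0 : ℝ)..max 0 (min s 1), f x‖ ≤ ‖f‖ := by
  have h := intervalIntegral.norm_integral_le_of_norm_le_const (a := 0) (b := max 0 (min s 1))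
    (fun x _ => f.norm_coe_le_norm x)
  have h1 : |max 0 (min s 1) - 0| ≤ 1 := by
    rw [sub_zero, abs_of_nonneg (le_max_left _ _)]
    exact max_le zero_le_one (min_le_right _ _)
  exact h.trans (mul_le_of_le_one_right (norm_nonneg f) h1)

/-- The operator `f ↦ (s ↦ ∫₀ˢ f)`, with `s` clamped to `[0, 1]`. -/
noncomputable def clampedPrimitive (E : Type*) [NormedAddCommGroup E] [NormedSpace ℝ E]
    [CompleteSpace E] : (ℝ →ᵇ E) →L[ℝ] (ℝ →ᵇ E) :=
  LinearMap.mkContinuous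
    { toFun := fun f => BoundedContinuousFunction.ofNormedAddCommGroup
        (fun s => ∫ x in (0 : ℝ)..max 0 (min s 1), f x)
        ((intervalIntegral.continuous_primitive
          (fun a b => f.continuous.intervalIntegrable a b) 0).comp (by fun_prop)) ‖f‖
        (norm_integral_zero_clamp_le f)
      map_add' := fun f g => by
        ext s
        exact intervalIntegral.integral_add (f.continuous.intervalIntegrable _ _)
          (g.continuous.intervalIntegrable _ _)
      map_smul' := fun c f => by
        ext s
        exact intervalIntegral.integral_smul c _ } 1
    fun f => (BoundedContinuousFunction.norm_ofNormedAddCommGroup_le _ (norm_nonneg f)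
      (norm_integral_zero_clamp_le f)).trans_eq (one_mul _).symm

theorem clampedPrimitive_apply [CompleteSpace E] (f : ℝ →ᵇ E) (s : ℝ) :
    clampedPrimitive E f s = ∫ x in (0 : ℝ)..max 0 (min s 1), f x := rfl

/-- The embedding of the constants into the bounded continuous functions. -/
noncomputable def constCLM (E : Type*) [NormedAddCommGroup E] [NormedSpace ℝ E] :
    E →L[ℝ] (ℝ →ᵇ E) :=
  LinearMap.mkContinuous
    { toFun := BoundedContinuousFunction.const ℝ
      map_add' := fun _ _ => rfl
      map_smul' := fun _ _ => rfl } 1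
    fun x => (BoundedContinuousFunction.norm_const_le x).trans_eq (one_mul _).symm

/-- Reparametrization of the time interval `[0, 1]`. -/
noncomputable def scaleClamp (c : ℝ) : C(ℝ, ℝ) := ⟨fun s => c * max 0 (min s 1), by fun_prop⟩

/-- This is the substitution `x ↦ c x`. It shows that slowing a trajectory down by the factor `c`
again gives a solution of the fixed point equation, with time parameter multiplied by `c`. -/
theorem clampedPrimitive_comp_scaleClamp [CompleteSpace E] (f : ℝ →ᵇ E) {c : ℝ}
    (hc : c ∈ Icc (0 : ℝ) 1) (s : ℝ) :
    clampedPrimitive E f (c * max 0 (min s 1)) =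
      c • clampedPrimitive E (f.compContinuous (scaleClamp c)) s := by
  rw [clampedPrimitive_apply, clampedPrimitive_apply]
  set σ := max 0 (min s 1) with hσ
  have h0 : 0 ≤ σ := le_max_left _ _
  have h1 : σ ≤ 1 := max_le zero_le_one (min_le_right _ _)
  have h2 : max 0 (min (c * σ) 1) = c * σ := by
    rw [min_eq_left (mul_le_one₀ hc.2 h0 h1), max_eq_right (mul_nonneg hc.1 h0)]
  have h3 : ∫ x in (0 : ℝ)..σ, f.compContinuous (scaleClamp c) x = ∫ x in (0 : ℝ)..σ, f (c * x) := by
    refine intervalIntegral.integral_congr fun x hx => ?_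
    rw [uIcc_of_le h0] at hx
    simp [scaleClamp, min_eq_left (hx.2.trans h1), max_eq_right hx.1]
  rw [h2, h3, intervalIntegral.smul_integral_comp_mul_left, mul_zero]

theorem hasDerivAt_integral_of_continuousOn_Ioo [CompleteSpace E] {δ t : ℝ} {F : ℝ → E}
    (hF : ContinuousOn F (Ioo (-δ) δ)) (ht : t ∈ Ioo (-δ) δ) :
    HasDerivAt (fun t => ∫ τ in (0 : ℝ)..t, F τ) (F t) t := by
  have h0 : (0 : ℝ) ∈ Ioo (-δ) δ := by constructor <;> linarith [ht.1, ht.2]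
  have hsub : uIcc 0 t ⊆ Ioo (-δ) δ := ordConnected_Ioo.uIcc_subset h0 ht
  exact intervalIntegral.integral_hasDerivAt_right (hF.mono hsub).intervalIntegrable
    (hF.stronglyMeasurableAtFilter isOpen_Ioo t ht) (hF.continuousAt (isOpen_Ioo.mem_nhds ht))

/-- A vector field whose superposition operator is analytic has an analytic local flow. -/
theorem exists_analytic_flow [CompleteSpace E] {F : E → E} {x₀ : E} {G : (ℝ →ᵇ E) → (ℝ →ᵇ E)}
    (hG : AnalyticAt ℝ G (BoundedContinuousFunction.const ℝ x₀))
    (hGF : ∀ᶠ h in 𝓝 (BoundedContinuousFunction.const ℝ x₀), ∀ s, G h s = F (h s))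
    {U : Set E} (hU : U ∈ 𝓝 x₀) :
    ∃ δ > 0, ∃ Y : ℝ × E → E, ∀ x ∈ Metric.ball x₀ δ, Y (0, x) = x ∧ ∀ t ∈ Ioo (-δ) δ,
      AnalyticAt ℝ Y (t, x) ∧ Y (t, x) ∈ U ∧
      HasDerivAt (fun t => Y (t, x)) (F (Y (t, x))) t := by
  set a₀ := BoundedContinuousFunction.const ℝ x₀ with ha₀
  obtain ⟨ρ, hρ, hρU⟩ := Metric.mem_nhds_iff.1 hU
  obtain ⟨V, ε, hε, hεU, δ₀, hδ₀, hV⟩ := hG.exists_fixedPoint_family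
    (Filter.inter_mem (hGF.and hG.eventually_analyticAt) (Metric.ball_mem_nhds a₀ hρ))
  set J := clampedPrimitive E with hJ
  have hJn : ‖J‖ ≤ 1 := LinearMap.mkContinuous_norm_le _ zero_le_one _
  -- Time is rescaled to `[0, 1]`: `y (t, x) s` is the trajectory of `x` at time `t s`, a fixed
  -- point of `y = x + t ∫₀ˢ F(y)`. Time thus becomes a factor of the small operator, and
  -- analyticity in `t` comes with that in `T`.
  let y : ℝ × E → (ℝ →ᵇ E) := fun q => V (q.1 • J, constCLM E q.2)
  have hsmall : ∀ t ∈ Ioo (-δ₀) δ₀, ‖t • J‖ < δ₀ := fun t ht => by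
    rw [norm_smul, Real.norm_eq_abs]
    exact (mul_le_of_le_one_right (abs_nonneg t) hJn).trans_lt (abs_lt.2 ht)
  have hsmall' : ∀ x ∈ Metric.ball x₀ δ₀, ‖constCLM E x - a₀‖ < δ₀ := fun x hx => by
    have : constCLM E x - a₀ = constCLM E (x - x₀) := by rw [map_sub]; rfl
    rw [this]
    refine (BoundedContinuousFunction.norm_const_le _).trans_lt ?_
    rwa [← dist_eq_norm]
  have hyan : ∀ t ∈ Ioo (-δ₀) δ₀, ∀ x ∈ Metric.ball x₀ δ₀, AnalyticAt ℝ y (t, x) :=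
    fun t ht x hx => by
    refine (hV _ _ (hsmall t ht) (hsmall' x hx)).1.comp_of_eq
      (f := fun q : ℝ × E => (q.1 • J, constCLM E q.2)) ?_ rfl
    exact (analyticAt_fst.smul analyticAt_const).prod
      ((constCLM E).analyticAt x |>.comp_of_eq analyticAt_snd rfl)
  have hymem : ∀ t ∈ Ioo (-δ₀) δ₀, ∀ x ∈ Metric.ball x₀ δ₀, y (t, x) ∈ Metric.ball a₀ ε :=
    fun t ht x hx => (hV _ _ (hsmall t ht) (hsmall' x hx)).2.1
  have hyeq : ∀ t ∈ Ioo (-δ₀) δ₀, ∀ x ∈ Metric.ball x₀ δ₀, ∀ s,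
      y (t, x) s = x + t • J (G (y (t, x))) s := fun t ht x hx s => by
    have := (hV _ _ (hsmall t ht) (hsmall' x hx)).2.2.1
    exact congrArg (fun h : ℝ →ᵇ E => h s) this
  -- The slowed trajectory solves the fixed point equation for the parameter `t * c` and stays in
  -- the uniqueness ball, so it is `y (t * c, x)`.
  have hscale : ∀ t ∈ Ioo (-δ₀) δ₀, ∀ x ∈ Metric.ball x₀ δ₀, ∀ c ∈ Icc (0 : ℝ) 1,
      y (t * c, x) 1 = y (t, x) c := fun t ht x hx c hc => by
    set v := (y (t, x)).compContinuous (scaleClamp c) with hv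
    have hvmem : v ∈ Metric.ball a₀ ε := by
      have h1 := hymem t ht x hx
      rw [Metric.mem_ball, dist_eq_norm] at h1 ⊢
      exact (BoundedContinuousFunction.norm_compContinuous_le
        (y (t, x) - a₀) (scaleClamp c)).trans_lt h1
    have htc : t * c ∈ Ioo (-δ₀) δ₀ := by
      rw [mem_Ioo, ← abs_lt, abs_mul, abs_of_nonneg hc.1]
      exact (mul_le_of_le_one_right (abs_nonneg t) hc.2).trans_lt (abs_lt.2 ht)
    have hGv : G v = (G (y (t, x))).compContinuous (scaleClamp c) := by
      ext s
      rw [(hεU hvmem).1.1 s]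
      exact ((hεU (hymem t ht x hx)).1.1 (scaleClamp c s)).symm
    have hveq : v = constCLM E x + (((t * c) • J : (ℝ →ᵇ E) →L[ℝ] (ℝ →ᵇ E))) (G v) := by
      ext s
      have h1 : v s = y (t, x) (c * max 0 (min s 1)) := rfl
      rw [h1, hyeq t ht x hx, hJ, clampedPrimitive_comp_scaleClamp _ hc, hGv, smul_smul]
      rfl
    have h2 : y (t * c, x) = v := (hV _ _ (hsmall _ htc) (hsmall' x hx)).2.2.2 v hvmem hveq
    rw [h2]
    simp [hv, scaleClamp]
  have hYan : ∀ t ∈ Ioo (-δ₀) δ₀, ∀ x ∈ Metric.ball x₀ δ₀,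
      AnalyticAt ℝ (fun q => y q 1) (t, x) := fun t ht x hx =>
    (ContinuousLinearMap.analyticAt (BoundedContinuousFunction.evalCLM ℝ (1 : ℝ) :
      (ℝ →ᵇ E) →L[ℝ] E) _).comp (hyan t ht x hx)
  refine ⟨δ₀, hδ₀, fun q => y q 1, fun x hx => ⟨?_, fun t ht => ⟨hYan t ht x hx, ?_, ?_⟩⟩⟩
  · refine (hyeq 0 ⟨by linarith, hδ₀⟩ x hx 1).trans ?_
    rw [zero_smul, add_zero]
  · apply hρU
    have h1 := (hεU (hymem t ht x hx)).2
    rw [Metric.mem_ball] at h1 ⊢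
    exact (BoundedContinuousFunction.dist_coe_le_dist (g := a₀) 1).trans_lt h1
  · have hGc : ContinuousOn (fun t => F (y (t, x) 1)) (Ioo (-δ₀) δ₀) := by
      have h1 : ContinuousOn (fun t => G (y (t, x)) 1) (Ioo (-δ₀) δ₀) := fun τ hτ => by
        have h2 : ContinuousAt (fun t => y (t, x)) τ :=
          (hyan τ hτ x hx).continuousAt.comp (f := fun t => (t, x)) (by fun_prop)
        have h3 : ContinuousAt (fun t => G (y (t, x))) τ :=
          ContinuousAt.comp (f := fun t => y (t, x)) (hεU (hymem τ hτ x hx)).1.2.continuousAt h2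
        exact ((BoundedContinuousFunction.evalCLM ℝ (1 : ℝ)).continuous.continuousAt.comp
          h3).continuousWithinAt
      exact h1.congr fun τ hτ => ((hεU (hymem τ hτ x hx)).1.1 1).symm
    -- By `hscale`, the fixed point equation at `s = 1` turns into the usual integral equation in
    -- the time variable.
    have hint : ∀ τ ∈ Ioo (-δ₀) δ₀, y (τ, x) 1 = x + ∫ σ in (0 : ℝ)..τ, F (y (σ, x) 1) :=
      fun τ hτ => by
      rw [hyeq τ hτ x hx, hJ, clampedPrimitive_apply]
      have h1 : max (0 : ℝ) (min 1 1) = 1 := by norm_num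
      rw [h1]
      have h2 : ∫ σ in (0 : ℝ)..1, G (y (τ, x)) σ = ∫ σ in (0 : ℝ)..1, F (y (τ * σ, x) 1) := by
        refine intervalIntegral.integral_congr fun σ hσ => ?_
        rw [uIcc_of_le zero_le_one] at hσ
        rw [hscale τ hτ x hx σ hσ, (hεU (hymem τ hτ x hx)).1.1]
      rw [h2, intervalIntegral.smul_integral_comp_mul_left (fun σ => F (y (σ, x) 1)) τ, mul_zero,
        mul_one]
    refine ((hasDerivAt_integral_of_continuousOn_Ioo hGc ht).const_add x).congr_of_eventuallyEq ?_
    exact eventually_of_mem (isOpen_Ioo.mem_nhds ht) hint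

end Flow

theorem analyticAt_radialNonlinearity {p w : ℝ} (hw : 0 < w) :
    AnalyticAt ℝ (fun w : ℝ => w / (p - 1) - |w| ^ (p - 1) * w) w := by
  have h1 : AnalyticAt ℝ (fun w : ℝ => w / (p - 1) - w ^ (p - 1) * w) w :=
    (analyticAt_id.div_const).sub
      ((Real.contDiffAt_rpow_const_of_ne hw.ne').analyticAt.mul analyticAt_id)
  refine h1.congr ?_
  filter_upwards [Ioi_mem_nhds hw] with y (hy : 0 < y)
  rw [abs_of_pos hy]

/-- The radial equation has an analytic local flow near positive data. -/
theorem exists_radial_flow {N : ℕ} {p : ℝ} {x₀ : ℝ × ℝ × ℝ} (hr : 0 < x₀.1)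
    (hw : 0 < x₀.2.1) :
    ∃ δ > 0, ∃ Y : ℝ × (ℝ × ℝ × ℝ) → ℝ × ℝ, ∀ x ∈ Metric.ball x₀ δ, Y (0, x) = x.2 ∧
      (∀ t ∈ Ioo (-δ) δ, AnalyticAt ℝ Y (t, x) ∧ 0 < (Y (t, x)).1) ∧
      SolvesOn N p (Ioo (x.1 - δ) (x.1 + δ)) (fun r => (Y (r - x.1, x)).1)
        (fun r => (Y (r - x.1, x)).2) := by
  -- The radius is adjoined as a coordinate of speed `1`. This makes the system autonomous and
  -- treats the initial radius as one more initial value.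
  let F : ℝ × ℝ × ℝ → ℝ × ℝ × ℝ := fun x => (1, x.2.2, radialRhs N p x.1 x.2.1 x.2.2)
  have hkr : AnalyticAt ℝ (fun r : ℝ => -(((N : ℝ) - 1) / r - r / 2)) x₀.1 :=
    ((analyticAt_const.div analyticAt_id hr.ne').sub analyticAt_id.div_const).neg
  obtain ⟨Gr, hGr, hGr'⟩ := hkr.exists_superposition
  obtain ⟨Gw, hGw, hGw'⟩ := (analyticAt_radialNonlinearity (p := p) hw).exists_superposition
  -- Coordinate projections and inclusions act pointwise on bounded functions, so the superposition
  -- operator of `F` is built from the two scalar ones `Gr` and `Gw`.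
  let P₁ : (ℝ →ᵇ ℝ × ℝ × ℝ) →L[ℝ] (ℝ →ᵇ ℝ) :=
    (ContinuousLinearMap.fst ℝ ℝ (ℝ × ℝ)).compLeftContinuousBounded ℝ
  let P₂ : (ℝ →ᵇ ℝ × ℝ × ℝ) →L[ℝ] (ℝ →ᵇ ℝ) := ((ContinuousLinearMap.fst ℝ ℝ ℝ).comp
    (ContinuousLinearMap.snd ℝ ℝ (ℝ × ℝ))).compLeftContinuousBounded ℝ
  let P₃ : (ℝ →ᵇ ℝ × ℝ × ℝ) →L[ℝ] (ℝ →ᵇ ℝ) := ((ContinuousLinearMap.snd ℝ ℝ ℝ).comp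
    (ContinuousLinearMap.snd ℝ ℝ (ℝ × ℝ))).compLeftContinuousBounded ℝ
  let I₂ : (ℝ →ᵇ ℝ) →L[ℝ] (ℝ →ᵇ ℝ × ℝ × ℝ) := ((ContinuousLinearMap.inr ℝ ℝ (ℝ × ℝ)).comp
    (ContinuousLinearMap.inl ℝ ℝ ℝ)).compLeftContinuousBounded ℝ
  let I₃ : (ℝ →ᵇ ℝ) →L[ℝ] (ℝ →ᵇ ℝ × ℝ × ℝ) := ((ContinuousLinearMap.inr ℝ ℝ (ℝ × ℝ)).comp
    (ContinuousLinearMap.inr ℝ ℝ ℝ)).compLeftContinuousBounded ℝ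
  set a₀ := BoundedContinuousFunction.const ℝ x₀
  let G : (ℝ →ᵇ ℝ × ℝ × ℝ) → (ℝ →ᵇ ℝ × ℝ × ℝ) := fun h =>
    BoundedContinuousFunction.const ℝ (1, 0, 0) + I₂ (P₃ h) +
      I₃ (Gr (P₁ h) * P₃ h + Gw (P₂ h))
  have hG : AnalyticAt ℝ G a₀ := by
    have h1 : AnalyticAt ℝ (fun h => Gr (P₁ h)) a₀ := hGr.comp_of_eq (P₁.analyticAt _) rfl
    have h2 : AnalyticAt ℝ (fun h => Gw (P₂ h)) a₀ := hGw.comp_of_eq (P₂.analyticAt _) rfl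
    exact (analyticAt_const.add ((I₂.analyticAt _).comp (P₃.analyticAt _))).add
      ((I₃.analyticAt _).comp ((h1.mul (P₃.analyticAt _)).add h2))
  have hGF : ∀ᶠ h in 𝓝 a₀, ∀ s, G h s = F (h s) := by
    have e1 := (P₁.continuous.tendsto a₀).eventually hGr'
    have e2 := (P₂.continuous.tendsto a₀).eventually hGw'
    filter_upwards [e1, e2] with h h1 h2 s
    simp only [G, F, BoundedContinuousFunction.coe_add, Pi.add_apply,
      BoundedContinuousFunction.coe_mul, Pi.mul_apply, I₂, I₃,
      ContinuousLinearMap.compLeftContinuousBounded_apply, h1, h2]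
    simp [P₁, P₂, P₃, radialRhs]
    ring
  have hU : {x : ℝ × ℝ × ℝ | 0 < x.2.1} ∈ 𝓝 x₀ :=
    (isOpen_lt continuous_const (by fun_prop)).mem_nhds hw
  obtain ⟨δ, hδ, Y, hY⟩ := exists_analytic_flow hG hGF hU
  refine ⟨δ, hδ, fun q => (Y q).2, fun x hx => ?_⟩
  obtain ⟨hY0, hYt⟩ := hY x hx
  have hcoord : ∀ t ∈ Ioo (-δ) δ, ∀ l : ℝ × ℝ × ℝ →L[ℝ] ℝ,
      HasDerivAt (fun t => l (Y (t, x))) (l (F (Y (t, x)))) t := fun t ht l =>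
    l.hasFDerivAt.comp_hasDerivAt t (hYt t ht).2.2
  have hfst : ∀ t ∈ Ioo (-δ) δ, (Y (t, x)).1 = x.1 + t := by
    have hd : ∀ t ∈ Ioo (-δ) δ, HasDerivAt (fun t => (Y (t, x)).1) 1 t := fun t ht =>
      hcoord t ht (ContinuousLinearMap.fst ℝ ℝ (ℝ × ℝ))
    have := isOpen_Ioo.eqOn_of_deriv_eq (f := fun t => (Y (t, x)).1) (g := fun t => x.1 + t)
      isPreconnected_Ioo (fun t ht => (hd t ht).differentiableAt.differentiableWithinAt)
      (by fun_prop) (fun t ht => by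
        rw [(hd t ht).deriv]; exact ((hasDerivAt_id t).const_add x.1).deriv.symm)
      (show (0 : ℝ) ∈ Ioo (-δ) δ by constructor <;> linarith) (by simp [hY0])
    exact this
  refine ⟨by simp [hY0], fun t ht => ⟨analyticAt_snd.comp (hYt t ht).1, (hYt t ht).2.1⟩, ?_⟩
  intro r hr
  have ht : r - x.1 ∈ Ioo (-δ) δ := by constructor <;> linarith [hr.1, hr.2]
  have hd2 := (hcoord _ ht ((ContinuousLinearMap.fst ℝ ℝ ℝ).comp
    (ContinuousLinearMap.snd ℝ ℝ (ℝ × ℝ)))).comp_sub_const r x.1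
  have hd3 := (hcoord _ ht ((ContinuousLinearMap.snd ℝ ℝ ℝ).comp
    (ContinuousLinearMap.snd ℝ ℝ (ℝ × ℝ)))).comp_sub_const r x.1
  refine ⟨hd2, hd3.congr_deriv ?_⟩
  have h1 : (Y (r - x.1, x)).1 = r := by rw [hfst _ ht]; ring
  simp [F, h1]

/-- Solutions depending analytically on a parameter at a fixed radius are jointly analytic. -/
theorem SolvesOn.analyticAt_uncurry {N : ℕ} {p b r₁ ℓ₁ : ℝ} {U G : ℝ → ℝ → ℝ} (hp : 1 < p)
    (hb : 0 ≤ b) (hr₁ : b < r₁) (hsol : ∀ᶠ ℓ in 𝓝 ℓ₁, SolvesOn N p (Ioi b) (U · ℓ) (G · ℓ))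
    (hpos : 0 < U r₁ ℓ₁) (hU : AnalyticAt ℝ (U r₁) ℓ₁) (hG : AnalyticAt ℝ (G r₁) ℓ₁) :
    AnalyticAt ℝ (fun q : ℝ × ℝ => (U q.1 q.2, G q.1 q.2)) (r₁, ℓ₁) := by
  let X : ℝ → ℝ × ℝ × ℝ := fun ℓ => (r₁, U r₁ ℓ, G r₁ ℓ)
  have hX : AnalyticAt ℝ X ℓ₁ := analyticAt_const.prod (hU.prod hG)
  obtain ⟨δ, hδ, Y, hY⟩ := exists_radial_flow (N := N) (p := p) (x₀ := X ℓ₁) (hb.trans_lt hr₁) hpos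
  have hYan : AnalyticAt ℝ (fun q : ℝ × ℝ => Y (q.1 - r₁, X q.2)) (r₁, ℓ₁) := by
    refine ((hY _ (Metric.mem_ball_self hδ)).2.1 0 ⟨by linarith, hδ⟩).1.comp_of_eq ?_ (by simp)
    exact (analyticAt_fst.sub analyticAt_const).prod (hX.comp_of_eq analyticAt_snd rfl)
  refine hYan.congr ?_
  have e1 : ∀ᶠ ℓ in 𝓝 ℓ₁, X ℓ ∈ Metric.ball (X ℓ₁) δ :=
    hX.continuousAt.eventually (Metric.ball_mem_nhds _ hδ)
  have e2 : ∀ᶠ r in 𝓝 r₁, r ∈ Ioo (max b (r₁ - δ)) (r₁ + δ) :=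
    Ioo_mem_nhds (max_lt hr₁ (by linarith)) (by linarith)
  filter_upwards [(e2.prod_nhds (e1.and hsol))] with q hq
  obtain ⟨hq1, hq2, hq3⟩ := hq
  obtain ⟨hY0, -, hYs⟩ := hY _ hq2
  have h1 := SolvesOn.eqOn_Ioo (c := r₁) hp (hb.trans (le_max_left _ (r₁ - δ)))
    (hYs.mono (Ioo_subset_Ioo_left (le_max_right b _)))
    (hq3.mono (Ioo_subset_Ioi_self.trans (Ioi_subset_Ioi (le_max_left _ _))))
    ⟨max_lt hr₁ (by linarith), by simp only [X]; linarith⟩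
    (by simp only [X, sub_self] at hY0 ⊢; rw [hY0])
    (by simp only [X, sub_self] at hY0 ⊢; rw [hY0]) hq1
  exact Prod.ext h1.1 h1.2

/-! ### Families of solutions and their continuation towards `r = 0` -/

/-- A family of positive solutions on `(b, ∞)`, parametrized analytically by the leading
coefficient `ℓ ∈ (ℓ₀ - θ, ℓ₀ + θ)` at infinity. -/
structure IsSolutionFamily (N : ℕ) (p b ℓ₀ θ : ℝ) (U G : ℝ → ℝ → ℝ) : Prop where
  solves : ∀ ℓ ∈ Ioo (ℓ₀ - θ) (ℓ₀ + θ), SolvesOn N p (Ioi b) (U · ℓ) (G · ℓ)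
  pos : ∀ ℓ ∈ Ioo (ℓ₀ - θ) (ℓ₀ + θ), ∀ r, b < r → 0 < U r ℓ
  tendsto : ∀ ℓ ∈ Ioo (ℓ₀ - θ) (ℓ₀ + θ),
    Tendsto (fun r : ℝ => r ^ (2 / (p - 1)) * U r ℓ) atTop (𝓝 ℓ)
  analyticAt : ∀ ℓ ∈ Ioo (ℓ₀ - θ) (ℓ₀ + θ), ∀ r, b < r →
    AnalyticAt ℝ (U r) ℓ ∧ AnalyticAt ℝ (G r) ℓ

theorem IsSolutionFamily.mono {N : ℕ} {p b b' ℓ₀ θ θ' : ℝ} {U G : ℝ → ℝ → ℝ}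
    (h : IsSolutionFamily N p b ℓ₀ θ U G) (hb : b ≤ b') (hθ : θ' ≤ θ) :
    IsSolutionFamily N p b' ℓ₀ θ' U G := by
  have hsub : Ioo (ℓ₀ - θ') (ℓ₀ + θ') ⊆ Ioo (ℓ₀ - θ) (ℓ₀ + θ) :=
    Ioo_subset_Ioo (by linarith) (by linarith)
  exact ⟨fun ℓ hℓ => (h.solves ℓ (hsub hℓ)).mono (Ioi_subset_Ioi hb),
    fun ℓ hℓ r hr => h.pos ℓ (hsub hℓ) r (hb.trans_lt hr), fun ℓ hℓ => h.tendsto ℓ (hsub hℓ),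
    fun ℓ hℓ r hr => h.analyticAt ℓ (hsub hℓ) r (hb.trans_lt hr)⟩

theorem IsSolutionFamily.analyticAt_uncurry {N : ℕ} {p b ℓ₀ θ : ℝ} {U G : ℝ → ℝ → ℝ}
    (h : IsSolutionFamily N p b ℓ₀ θ U G) (hp : 1 < p) (hb : 0 ≤ b) {r ℓ : ℝ} (hr : b < r)
    (hℓ : ℓ ∈ Ioo (ℓ₀ - θ) (ℓ₀ + θ)) :
    AnalyticAt ℝ (fun q : ℝ × ℝ => (U q.1 q.2, G q.1 q.2)) (r, ℓ) :=
  SolvesOn.analyticAt_uncurry hp hb hr (eventually_of_mem (isOpen_Ioo.mem_nhds hℓ) h.solves)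
    (h.pos ℓ hℓ r hr) (h.analyticAt ℓ hℓ r hr).1 (h.analyticAt ℓ hℓ r hr).2

/-- The gain `η` depends only on `φ` near `r₁`, not on `b` or on the family. A family starting
slightly to the right of `r₁` can thus be carried past `r₁`: at some `c` in `(b, r₁ + η)` its data
for `ℓ` near `ℓ₀` are close to those of `φ` at `r₁`, and the analytic flow of length `δ` continues
it to the left. -/
theorem IsSolutionFamily.exists_extension {N : ℕ} {p ℓ₀ r₁ : ℝ} (hp : 1 < p) {φ ψ : ℝ → ℝ}
    (hφ : SolvesOn N p (Ioi 0) φ ψ) (hφpos : ∀ r, 0 < r → 0 < φ r) (hr₁ : 0 < r₁) :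
    ∃ η > 0, η < r₁ ∧ ∀ b θ U G, 0 < θ → r₁ ≤ b → b < r₁ + η → IsSolutionFamily N p b ℓ₀ θ U G →
      (∀ r, b < r → U r ℓ₀ = φ r ∧ G r ℓ₀ = ψ r) →
      ∃ θ' > 0, ∃ U' G', IsSolutionFamily N p (r₁ - η) ℓ₀ θ' U' G' := by
  obtain ⟨δ, hδ, Y, hY⟩ := exists_radial_flow (N := N) (p := p) (x₀ := (r₁, φ r₁, ψ r₁)) hr₁
    (hφpos r₁ hr₁)
  have hcont : ContinuousAt (fun r => (r, φ r, ψ r)) r₁ :=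
    continuousAt_id.prodMk ((hφ r₁ hr₁).1.continuousAt.prodMk (hφ r₁ hr₁).2.continuousAt)
  obtain ⟨η₀, hη₀, hη₀s⟩ := Metric.eventually_nhds_iff.1
    (hcont.eventually (Metric.ball_mem_nhds _ hδ))
  -- `η₀` keeps the data of `φ` in the ball where the flow exists, `δ / 2` lets the flow from `c <
  -- r₁ + η` reach `r₁ - η`, and `r₁ / 2` keeps radii positive.
  refine ⟨min η₀ (min (δ / 2) (r₁ / 2)), by positivity, ?_, ?_⟩
  · exact ((min_le_right _ _).trans (min_le_right _ _)).trans_lt (by linarith)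
  intro b θ U G hθ hrb hbη hfam heq
  set η := min η₀ (min (δ / 2) (r₁ / 2)) with hη
  have hηδ : η ≤ δ / 2 := (min_le_right _ _).trans (min_le_left _ _)
  have hηr : η ≤ r₁ / 2 := (min_le_right _ _).trans (min_le_right _ _)
  obtain ⟨c, hbc, hcη⟩ := exists_between hbη
  have hℓ₀ : ℓ₀ ∈ Ioo (ℓ₀ - θ) (ℓ₀ + θ) := by constructor <;> linarith
  let X : ℝ → ℝ × ℝ × ℝ := fun ℓ => (c, U c ℓ, G c ℓ)
  have hXan : ∀ ℓ ∈ Ioo (ℓ₀ - θ) (ℓ₀ + θ), AnalyticAt ℝ X ℓ := fun ℓ hℓ =>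
    analyticAt_const.prod ((hfam.analyticAt ℓ hℓ c hbc).1.prod (hfam.analyticAt ℓ hℓ c hbc).2)
  have hX₀ : X ℓ₀ ∈ Metric.ball (r₁, φ r₁, ψ r₁) δ := by
    have h1 : X ℓ₀ = (c, φ c, ψ c) := by simp only [X, (heq c hbc).1, (heq c hbc).2]
    rw [h1]
    refine hη₀s ?_
    rw [Real.dist_eq, abs_of_nonneg (by linarith)]
    have : η ≤ η₀ := min_le_left _ _
    linarith
  obtain ⟨θ₁, hθ₁, hθ₁s⟩ := Metric.eventually_nhds_iff.1
    ((hXan ℓ₀ hℓ₀).continuousAt.eventually (Metric.isOpen_ball.mem_nhds hX₀))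
  refine ⟨min θ₁ θ, lt_min hθ₁ hθ, fun r ℓ => if c ≤ r then U r ℓ else (Y (r - c, X ℓ)).1,
    fun r ℓ => if c ≤ r then G r ℓ else (Y (r - c, X ℓ)).2, ?_⟩
  have hI : ∀ ℓ ∈ Ioo (ℓ₀ - min θ₁ θ) (ℓ₀ + min θ₁ θ), ℓ ∈ Ioo (ℓ₀ - θ) (ℓ₀ + θ) ∧
      X ℓ ∈ Metric.ball (r₁, φ r₁, ψ r₁) δ := fun ℓ hℓ => by
    have h1 := min_le_left θ₁ θ
    have h2 := min_le_right θ₁ θ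
    refine ⟨⟨by linarith [hℓ.1], by linarith [hℓ.2]⟩, hθ₁s ?_⟩
    rw [Real.dist_eq, abs_lt]
    constructor <;> linarith [hℓ.1, hℓ.2]
  have hagree : ∀ ℓ ∈ Ioo (ℓ₀ - min θ₁ θ) (ℓ₀ + min θ₁ θ), ∀ r ∈ Ioo b (c + δ),
      U r ℓ = (Y (r - c, X ℓ)).1 ∧ G r ℓ = (Y (r - c, X ℓ)).2 := fun ℓ hℓ r hr => by
    obtain ⟨hY0, -, hYs⟩ := hY _ (hI ℓ hℓ).2
    refine SolvesOn.eqOn_Ioo (f₁ := (U · ℓ)) (g₁ := (G · ℓ)) (c := c) hp (hr₁.le.trans hrb)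
      ((hfam.solves ℓ (hI ℓ hℓ).1).mono Ioo_subset_Ioi_self)
      (hYs.mono (Ioo_subset_Ioo_left ?_)) ⟨hbc, by linarith⟩ ?_ ?_ hr
    · simp only [X]; linarith
    · simp only [X, sub_self] at hY0 ⊢; rw [hY0]
    · simp only [X, sub_self] at hY0 ⊢; rw [hY0]
  have hcase : ∀ r, r₁ - η < r → b < r ∨ r ∈ Ioo (c - δ) c := fun r hr => by
    rcases lt_or_ge b r with h | h
    · exact Or.inl h
    · exact Or.inr ⟨by linarith, by linarith⟩
  have hU' : ∀ ℓ ∈ Ioo (ℓ₀ - min θ₁ θ) (ℓ₀ + min θ₁ θ), ∀ r, b < r →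
      (if c ≤ r then U r ℓ else (Y (r - c, X ℓ)).1) = U r ℓ ∧
      (if c ≤ r then G r ℓ else (Y (r - c, X ℓ)).2) = G r ℓ := fun ℓ hℓ r hr => by
    split_ifs with h
    · exact ⟨rfl, rfl⟩
    · have := hagree ℓ hℓ r ⟨hr, by linarith⟩
      exact ⟨this.1.symm, this.2.symm⟩
  have hY' : ∀ ℓ, ∀ r ∈ Ioo (c - δ) c,
      (if c ≤ r then U r ℓ else (Y (r - c, X ℓ)).1) = (Y (r - c, X ℓ)).1 ∧
      (if c ≤ r then G r ℓ else (Y (r - c, X ℓ)).2) = (Y (r - c, X ℓ)).2 := fun ℓ r hr => by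
    rw [if_neg (not_le.2 hr.2), if_neg (not_le.2 hr.2)]
    exact ⟨rfl, rfl⟩
  refine ⟨fun ℓ hℓ r hr => ?_, fun ℓ hℓ r hr => ?_, fun ℓ hℓ => ?_, fun ℓ hℓ r hr => ?_⟩
  · rcases hcase r hr with h | h
    · exact SolvesOn.congr isOpen_Ioi (hfam.solves ℓ (hI ℓ hℓ).1)
        (fun r hr => (hU' ℓ hℓ r hr).1) (fun r hr => (hU' ℓ hℓ r hr).2) r h
    · exact SolvesOn.congr isOpen_Ioo ((hY _ (hI ℓ hℓ).2).2.2.mono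
        (Ioo_subset_Ioo_right (by simp only [X]; linarith)))
        (fun r hr => (hY' ℓ r hr).1) (fun r hr => (hY' ℓ r hr).2) r h
  · rcases hcase r hr with h | h
    · rw [(hU' ℓ hℓ r h).1]; exact hfam.pos ℓ (hI ℓ hℓ).1 r h
    · rw [(hY' ℓ r h).1]
      exact ((hY _ (hI ℓ hℓ).2).2.1 (r - c) ⟨by linarith [h.1], by linarith [h.2]⟩).2
  · refine (hfam.tendsto ℓ (hI ℓ hℓ).1).congr' ?_
    filter_upwards [eventually_gt_atTop b] with r hr
    rw [(hU' ℓ hℓ r hr).1]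
  · have hn : Ioo (ℓ₀ - min θ₁ θ) (ℓ₀ + min θ₁ θ) ∈ 𝓝 ℓ := isOpen_Ioo.mem_nhds hℓ
    rcases hcase r hr with h | h
    · obtain ⟨h1, h2⟩ := hfam.analyticAt ℓ (hI ℓ hℓ).1 r h
      exact ⟨h1.congr (eventually_of_mem hn fun ℓ hℓ => (hU' ℓ hℓ r h).1.symm),
        h2.congr (eventually_of_mem hn fun ℓ hℓ => (hU' ℓ hℓ r h).2.symm)⟩
    · have h1 : AnalyticAt ℝ (fun ℓ => Y (r - c, X ℓ)) ℓ :=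
        ((hY _ (hI ℓ hℓ).2).2.1 (r - c) ⟨by linarith [h.1], by linarith [h.2]⟩).1.comp_of_eq
          (analyticAt_const.prod (hXan ℓ (hI ℓ hℓ).1)) rfl
      exact ⟨(analyticAt_fst.comp h1).congr (Eventually.of_forall fun ℓ => (hY' ℓ r h).1.symm),
        (analyticAt_snd.comp h1).congr (Eventually.of_forall fun ℓ => (hY' ℓ r h).2.symm)⟩

/-- If one family of solutions exists near infinity and the solution for `ℓ₀` is global, then
families of solutions exist on all intervals `(b, ∞)`. -/
theorem IsSolutionFamily.exists_of_global {N : ℕ} {p ℓ₀ : ℝ} (hp : 1 < p) {φ ψ : ℝ → ℝ}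
    (hφ : SolvesOn N p (Ioi 0) φ ψ) (hφpos : ∀ r, 0 < r → 0 < φ r)
    (huniq : ∀ b θ U G, 0 ≤ b → 0 < θ → IsSolutionFamily N p b ℓ₀ θ U G →
      ∀ r, b < r → U r ℓ₀ = φ r ∧ G r ℓ₀ = ψ r)
    (hex : ∃ b > 0, ∃ θ > 0, ∃ U G, IsSolutionFamily N p b ℓ₀ θ U G) {b : ℝ} (hb : 0 < b) :
    ∃ θ > 0, ∃ U G, IsSolutionFamily N p b ℓ₀ θ U G := by
  -- If the infimum of the admissible left endpoints were positive, `exists_extension` applied there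
  -- would produce a smaller one.
  let B : Set ℝ := {b | 0 < b ∧ ∃ θ > 0, ∃ U G, IsSolutionFamily N p b ℓ₀ θ U G}
  have hBne : B.Nonempty := by
    obtain ⟨b, hb, h⟩ := hex
    exact ⟨b, hb, h⟩
  have hBbdd : BddBelow B := ⟨0, fun b hb => hb.1.le⟩
  have hi0 : 0 ≤ sInf B := le_csInf hBne fun b hb => hb.1.le
  have hlt : sInf B < b := by
    rcases hi0.eq_or_lt with h | h
    · rwa [← h]
    · exfalso
      obtain ⟨η, hη, hηr, hstep⟩ := IsSolutionFamily.exists_extension (ℓ₀ := ℓ₀) hp hφ hφpos h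
      obtain ⟨b', ⟨hb'0, θ, hθ, U, G, hfam⟩, hb'⟩ :=
        exists_lt_of_csInf_lt hBne (show sInf B < sInf B + η by linarith)
      have hle : sInf B ≤ b' := csInf_le hBbdd ⟨hb'0, θ, hθ, U, G, hfam⟩
      obtain ⟨θ', hθ', U', G', hfam'⟩ := hstep b' θ U G hθ hle hb' hfam
        (huniq b' θ U G hb'0.le hθ hfam)
      have := csInf_le hBbdd (show sInf B - η ∈ B from ⟨by linarith, θ', hθ', U', G', hfam'⟩)
      linarith
  obtain ⟨b', ⟨-, θ, hθ, U, G, hfam⟩, hb'⟩ := exists_lt_of_csInf_lt hBne hlt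
  exact ⟨θ, hθ, U, G, hfam.mono hb'.le le_rfl⟩

/-! ### Tail integrals with Gaussian weight -/

section TailIntegrals

open MeasureTheory

theorem integrableOn_Ioi_of_continuousOn {k : ℝ → ℝ} {c r : ℝ} (hk : ContinuousOn k (Ioi 0))
    (hi : IntegrableOn k (Ioi c)) (hr : 0 < r) : IntegrableOn k (Ioi r) := by
  have h1 : IntegrableOn k (Icc r (max r c)) :=
    (hk.mono fun s hs => hr.trans_le hs.1).integrableOn_Icc
  refine (h1.union hi).mono_set fun s (hs : r < s) => ?_
  rcases le_or_gt s c with h | h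
  · exact Or.inl ⟨hs.le, h.trans (le_max_right _ _)⟩
  · exact Or.inr h

theorem hasDerivAt_integral_Ioi {k : ℝ → ℝ} {c r : ℝ} (hk : ContinuousOn k (Ioi 0))
    (hi : IntegrableOn k (Ioi c)) (hr : 0 < r) :
    HasDerivAt (fun r => ∫ s in Ioi r, k s) (-k r) r := by
  have hr2 : 0 < r / 2 := by positivity
  have h1 : HasDerivAt (fun y => (∫ s in Ioi (r / 2), k s) - ∫ s in (r / 2)..y, k s) (-k r) r := by
    rw [← zero_sub]
    refine (hasDerivAt_const r _).sub (intervalIntegral.integral_hasDerivAt_right ?_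
      (hk.stronglyMeasurableAtFilter isOpen_Ioi r hr) (hk.continuousAt (isOpen_Ioi.mem_nhds hr)))
    refine (hk.mono ?_).intervalIntegrable
    exact (ordConnected_Ioi.uIcc_subset hr2 hr)
  refine h1.congr_of_eventuallyEq ?_
  filter_upwards [Ioi_mem_nhds hr] with y hy
  rw [← intervalIntegral.integral_interval_add_Ioi
    (integrableOn_Ioi_of_continuousOn hk hi hr2) (integrableOn_Ioi_of_continuousOn hk hi hy)]
  ring

theorem integrableOn_Ioi_mul_bounded {k : ℝ → ℝ} {r : ℝ} (hi : IntegrableOn k (Ioi r))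
    (f : ℝ →ᵇ ℝ) : IntegrableOn (fun s => k s * f s) (Ioi r) :=
  Integrable.mul_bdd (c := ‖f‖) hi f.continuous.aestronglyMeasurable
    (Eventually.of_forall f.norm_coe_le_norm)

theorem abs_integral_Ioi_mul_le {k : ℝ → ℝ} {r : ℝ} (hi : IntegrableOn k (Ioi r))
    (hk0 : ∀ s, r < s → 0 ≤ k s) (f : ℝ →ᵇ ℝ) :
    |∫ s in Ioi r, k s * f s| ≤ ‖f‖ * ∫ s in Ioi r, k s := by
  rw [← integral_const_mul]
  refine norm_integral_le_of_norm_le (f := fun s => k s * f s) (hi.const_mul ‖f‖) ?_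
  filter_upwards [ae_restrict_mem measurableSet_Ioi] with s hs
  rw [norm_mul, Real.norm_of_nonneg (hk0 s hs), mul_comm]
  exact mul_le_mul_of_nonneg_right (f.norm_coe_le_norm s) (hk0 s hs)

/-- Weighted tail integrals, restricted to radii at least `R`, as bounded operators. -/
theorem exists_tailOperator {k c : ℝ → ℝ} {R M : ℝ} (hR : 0 < R) (hk : ContinuousOn k (Ioi 0))
    (hk0 : ∀ s, 0 < s → 0 ≤ k s) (hi : IntegrableOn k (Ioi R)) (hc : ContinuousOn c (Ioi 0))
    (hM0 : 0 ≤ M) (hM : ∀ x, R ≤ x → |c x| * (∫ s in Ioi x, k s) ≤ M) :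
    ∃ T : (ℝ →ᵇ ℝ) →L[ℝ] (ℝ →ᵇ ℝ), ‖T‖ ≤ M ∧
      ∀ f r, T f r = c (max r R) * ∫ s in Ioi (max r R), k s * f s := by
  have hpos : ∀ r, 0 < max r R := fun r => hR.trans_le (le_max_right _ _)
  have hint : ∀ r, IntegrableOn k (Ioi (max r R)) := fun r =>
    hi.mono_set (Ioi_subset_Ioi (le_max_right _ _))
  have hbound : ∀ (f : ℝ →ᵇ ℝ) r, ‖c (max r R) * ∫ s in Ioi (max r R), k s * f s‖ ≤ M * ‖f‖ :=
    fun f r => by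
    rw [norm_mul, Real.norm_eq_abs, Real.norm_eq_abs]
    have h1 := abs_integral_Ioi_mul_le (hint r) (fun s hs => hk0 s ((hpos r).trans hs)) f
    have h2 := hM (max r R) (le_max_right _ _)
    calc _ ≤ |c (max r R)| * (‖f‖ * ∫ s in Ioi (max r R), k s) :=
          mul_le_mul_of_nonneg_left h1 (abs_nonneg _)
      _ = (|c (max r R)| * ∫ s in Ioi (max r R), k s) * ‖f‖ := by ring
      _ ≤ M * ‖f‖ := mul_le_mul_of_nonneg_right h2 (norm_nonneg f)
  have hcont : ∀ f : ℝ →ᵇ ℝ, Continuous fun r =>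
      c (max r R) * ∫ s in Ioi (max r R), k s * f s := fun f => by
    have h1 : ContinuousOn (fun r => c r * ∫ s in Ioi r, k s * f s) (Ioi 0) :=
      hc.mul fun r hr => (hasDerivAt_integral_Ioi (hk.mul f.continuous.continuousOn)
        (integrableOn_Ioi_mul_bounded hi f) hr).continuousAt.continuousWithinAt
    exact h1.comp_continuous (f := fun r => max r R) (by fun_prop) hpos
  refine ⟨LinearMap.mkContinuous
    { toFun := fun f => BoundedContinuousFunction.ofNormedAddCommGroup _ (hcont f) _ (hbound f)
      map_add' := fun f g => by
        ext r
        have := integral_add (integrableOn_Ioi_mul_bounded (hint r) f)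
          (integrableOn_Ioi_mul_bounded (hint r) g)
        simp only [BoundedContinuousFunction.coe_ofNormedAddCommGroup,
          BoundedContinuousFunction.coe_add, Pi.add_apply, mul_add]
        rw [this, mul_add]
      map_smul' := fun t f => by
        ext r
        simp only [BoundedContinuousFunction.coe_ofNormedAddCommGroup,
          BoundedContinuousFunction.coe_smul, smul_eq_mul, RingHom.id_apply]
        have : ∀ s, k s * (t * f s) = t * (k s * f s) := fun s => by ring
        simp only [this]
        rw [integral_const_mul]
        ring } M fun f =>
      BoundedContinuousFunction.norm_ofNormedAddCommGroup_le _ (by positivity) (hbound f),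
    LinearMap.mkContinuous_norm_le _ hM0 _, fun f r => rfl⟩

/-- The integrating factor `s^a e^{-s²/4}` of `v'' + (a/s - s/2) v'`. -/
noncomputable def gaussWeight (a s : ℝ) : ℝ := s ^ a * Real.exp (-(s ^ 2 / 4))

theorem gaussWeight_pos (a : ℝ) {s : ℝ} (hs : 0 < s) : 0 < gaussWeight a s :=
  mul_pos (Real.rpow_pos_of_pos hs a) (Real.exp_pos _)

theorem hasDerivAt_gaussWeight (a : ℝ) {s : ℝ} (hs : 0 < s) :
    HasDerivAt (gaussWeight a) (gaussWeight a s * (a / s - s / 2)) s := by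
  have h1 : HasDerivAt (fun s : ℝ => -(s ^ 2 / 4)) (-(s / 2)) s := by
    refine (((hasDerivAt_pow 2 s).div_const 4).neg).congr_deriv ?_
    norm_num
    ring
  refine ((Real.hasDerivAt_rpow_const (Or.inl hs.ne')).mul h1.exp).congr_deriv ?_
  rw [gaussWeight, Real.rpow_sub_one hs.ne']
  field_simp
  ring

theorem continuousOn_gaussWeight (a : ℝ) : ContinuousOn (gaussWeight a) (Ioi 0) := fun _ hs =>
  (hasDerivAt_gaussWeight a hs).continuousAt.continuousWithinAt

theorem tendsto_gaussWeight (a : ℝ) : Tendsto (gaussWeight a) atTop (𝓝 0) := by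
  have h1 := tendsto_rpow_mul_exp_neg_mul_atTop_nhds_zero a (1 / 4) (by norm_num)
  refine squeeze_zero' ?_ ?_ h1
  · filter_upwards [eventually_gt_atTop 0] with s hs using (gaussWeight_pos a hs).le
  · filter_upwards [eventually_ge_atTop 1] with s hs
    refine mul_le_mul_of_nonneg_left (Real.exp_le_exp.2 ?_) (Real.rpow_nonneg (by linarith) a)
    nlinarith

/-- Threshold beyond which the tails of `gaussWeight a` are controlled. -/
noncomputable def tailRadius (a : ℝ) : ℝ := 1 + 4 * |a|

theorem one_le_tailRadius (a : ℝ) : 1 ≤ tailRadius a := by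
  unfold tailRadius; linarith [abs_nonneg a]

/-- The function `-4 W s⁻³` has derivative `W s⁻² (2 + (12 - 4a)/s²)`, and beyond `tailRadius a` the
bracket is at least `1`, since `4|a| ≤ s ≤ s²`. -/
theorem gaussWeight_tail (a : ℝ) {r : ℝ} (hr : tailRadius a ≤ r) :
    IntegrableOn (fun s => gaussWeight a s * (s ^ 2)⁻¹) (Ioi r) ∧
      ∫ s in Ioi r, gaussWeight a s * (s ^ 2)⁻¹ ≤ 4 * gaussWeight a r / r ^ 3 := by
  have hr1 : 1 ≤ r := (one_le_tailRadius a).trans hr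
  have hr0 : 0 < r := by linarith
  have hd : ∀ s ∈ Ici r, HasDerivAt (fun s => -(4 * gaussWeight a s / s ^ 3))
      (gaussWeight a s * (s ^ 2)⁻¹ * (2 + (12 - 4 * a) / s ^ 2)) s := fun s hs => by
    have hs0 : 0 < s := hr0.trans_le hs
    refine ((((hasDerivAt_gaussWeight a hs0).const_mul 4).div (hasDerivAt_pow 3 s)
      (by positivity)).neg).congr_deriv ?_
    field_simp
    ring
  have hle : ∀ s, r ≤ s → gaussWeight a s * (s ^ 2)⁻¹ ≤
      gaussWeight a s * (s ^ 2)⁻¹ * (2 + (12 - 4 * a) / s ^ 2) := fun s hs => by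
    have hs0 : 0 < s := hr0.trans_le hs
    have hw := gaussWeight_pos a hs0
    refine le_mul_of_one_le_right (by positivity) ?_
    have h1 : -1 ≤ (12 - 4 * a) / s ^ 2 := by
      rw [le_div_iff₀ (by positivity)]
      have h2 : 4 * |a| ≤ s := by unfold tailRadius at hr; linarith
      have h3 : 1 ≤ s := hr1.trans hs
      nlinarith [le_abs_self a]
    linarith
  have hnonneg : ∀ s, r ≤ s → 0 ≤ gaussWeight a s * (s ^ 2)⁻¹ := fun s hs => by
    have hs0 : 0 < s := hr0.trans_le hs
    have hw := gaussWeight_pos a hs0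
    positivity
  have hlim : Tendsto (fun s => -(4 * gaussWeight a s / s ^ 3)) atTop (𝓝 0) := by
    have h1 : Tendsto (fun s : ℝ => (s ^ 3)⁻¹) atTop (𝓝 0) :=
      (tendsto_pow_atTop (by norm_num)).inv_tendsto_atTop
    simpa [div_eq_mul_inv] using (((tendsto_gaussWeight a).const_mul 4).mul h1).neg
  have hint := integrableOn_Ioi_deriv_of_nonneg' hd
    (fun s hs => (hnonneg s (le_of_lt hs)).trans (hle s (le_of_lt hs))) hlim
  have hval := integral_Ioi_of_hasDerivAt_of_nonneg' hd
    (fun s hs => (hnonneg s (le_of_lt hs)).trans (hle s (le_of_lt hs))) hlim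
  have hint' : IntegrableOn (fun s => gaussWeight a s * (s ^ 2)⁻¹) (Ioi r) := by
    refine Integrable.mono' hint ?_ ?_
    · refine ContinuousOn.aestronglyMeasurable ?_ measurableSet_Ioi
      refine ((continuousOn_gaussWeight a).mono (Ioi_subset_Ioi hr0.le)).mul
        (ContinuousOn.inv₀ (by fun_prop) fun s hs => ?_)
      have : 0 < s := hr0.trans hs
      positivity
    · filter_upwards [ae_restrict_mem measurableSet_Ioi] with s hs
      rw [Real.norm_of_nonneg (hnonneg s (le_of_lt hs))]
      exact hle s (le_of_lt hs)
  refine ⟨hint', ?_⟩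
  calc _ ≤ ∫ s in Ioi r, gaussWeight a s * (s ^ 2)⁻¹ * (2 + (12 - 4 * a) / s ^ 2) :=
        setIntegral_mono_on hint' hint measurableSet_Ioi fun s hs => hle s (le_of_lt hs)
    _ = 4 * gaussWeight a r / r ^ 3 := by rw [hval]; ring

theorem inv_pow_three_tail {r : ℝ} (hr : 0 < r) :
    IntegrableOn (fun s : ℝ => (s ^ 3)⁻¹) (Ioi r) ∧
      ∫ s in Ioi r, (s ^ 3)⁻¹ = (2 * r ^ 2)⁻¹ := by
  have hd : ∀ s ∈ Ici r, HasDerivAt (fun s : ℝ => -(2 * s ^ 2)⁻¹) ((s ^ 3)⁻¹) s := fun s hs => by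
    have hs0 : 0 < s := hr.trans_le hs
    refine ((((hasDerivAt_pow 2 s).const_mul 2).inv (by positivity)).neg).congr_deriv ?_
    field_simp
    norm_num
  have hnn : ∀ s ∈ Ioi r, (0 : ℝ) ≤ (s ^ 3)⁻¹ := fun s hs => by
    have hs0 : 0 < s := hr.trans hs
    positivity
  have hlim : Tendsto (fun s : ℝ => -(2 * s ^ 2)⁻¹) atTop (𝓝 0) := by
    have : Tendsto (fun s : ℝ => 2 * s ^ 2) atTop atTop :=
      (tendsto_pow_atTop (by norm_num)).const_mul_atTop (by norm_num)
    have h := this.inv_tendsto_atTop.neg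
    rw [neg_zero] at h
    exact h
  refine ⟨integrableOn_Ioi_deriv_of_nonneg' hd hnn hlim, ?_⟩
  rw [integral_Ioi_of_hasDerivAt_of_nonneg' hd hnn hlim]
  ring

/-- The tail integral `∫_r^∞ s^a e^{-s²/4} s⁻² f(s) ds`. -/
noncomputable def gaussTail (a : ℝ) (f : ℝ → ℝ) (r : ℝ) : ℝ :=
  ∫ s in Ioi r, gaussWeight a s * (s ^ 2)⁻¹ * f s

theorem continuousOn_gaussWeight_mul_inv_sq (a : ℝ) :
    ContinuousOn (fun s => gaussWeight a s * (s ^ 2)⁻¹) (Ioi 0) :=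
  (continuousOn_gaussWeight a).mul (ContinuousOn.inv₀ (by fun_prop) fun s hs => by
    have : 0 < s := hs
    positivity)

theorem hasDerivAt_gaussTail (a : ℝ) (f : ℝ →ᵇ ℝ) {r : ℝ} (hr : 0 < r) :
    HasDerivAt (gaussTail a f) (-(gaussWeight a r * (r ^ 2)⁻¹ * f r)) r :=
  hasDerivAt_integral_Ioi
    ((continuousOn_gaussWeight_mul_inv_sq a).mul f.continuous.continuousOn)
    (integrableOn_Ioi_mul_bounded (gaussWeight_tail a le_rfl).1 f) hr

/-- The quotient is the only possible `v'` for a convergent profile. Its cubic decay makes `v'`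
integrable and is the source of the rates in (2). -/
theorem abs_gaussTail_div_le (a : ℝ) (f : ℝ →ᵇ ℝ) {r : ℝ} (hr : tailRadius a ≤ r) :
    |gaussTail a f r / gaussWeight a r| ≤ 4 * ‖f‖ * (r ^ 3)⁻¹ := by
  have hr0 : 0 < r := by linarith [one_le_tailRadius a]
  have hw := gaussWeight_pos a hr0
  have h1 := abs_integral_Ioi_mul_le (gaussWeight_tail a hr).1 (fun s hs => by
    have hs0 : 0 < s := hr0.trans hs
    have := gaussWeight_pos a hs0
    positivity) f
  rw [abs_div, abs_of_pos hw, div_le_iff₀ hw]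
  calc _ ≤ ‖f‖ * (4 * gaussWeight a r / r ^ 3) :=
        h1.trans (mul_le_mul_of_nonneg_left (gaussWeight_tail a hr).2 (norm_nonneg f))
    _ = _ := by field_simp

/-- The inversion of `v'' + (a/r - r/2) v'` on `(R, ∞)` with zero data at infinity, factored
through the rescaled derivative `r³ v'`. -/
theorem exists_profileOperators (a : ℝ) {R : ℝ} (hR : tailRadius a ≤ R) :
    ∃ S J : (ℝ →ᵇ ℝ) →L[ℝ] (ℝ →ᵇ ℝ), ‖J.comp S‖ ≤ 2 / R ^ 2 ∧
      (∀ f r, R ≤ r → S f r = r ^ 3 * (gaussTail a f r / gaussWeight a r)) ∧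
      (∀ f r, J f r = -∫ s in Ioi (max r R), (s ^ 3)⁻¹ * f s) := by
  have hR0 : 0 < R := by linarith [one_le_tailRadius a]
  -- By `gaussWeight_tail`, `r³ v'` is bounded by `4 ‖f‖` whatever `R` is. The smallness for large
  -- `R` comes from `J`, of norm at most `1/(2R²)`.
  obtain ⟨S, hS, hSf⟩ := exists_tailOperator (c := fun x => x ^ 3 / gaussWeight a x) (M := 4) hR0
    (continuousOn_gaussWeight_mul_inv_sq a) (fun s hs => by
      have := gaussWeight_pos a hs
      positivity) (gaussWeight_tail a hR).1
    (ContinuousOn.div (by fun_prop) (continuousOn_gaussWeight a) fun s hs =>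
      (gaussWeight_pos a hs).ne') (by norm_num) (fun x hx => by
      have hx0 : 0 < x := hR0.trans_le hx
      have hw := gaussWeight_pos a hx0
      rw [abs_of_pos (by positivity)]
      calc _ ≤ x ^ 3 / gaussWeight a x * (4 * gaussWeight a x / x ^ 3) :=
            mul_le_mul_of_nonneg_left (gaussWeight_tail a (hR.trans hx)).2 (by positivity)
        _ = 4 := by field_simp)
  obtain ⟨J, hJ, hJf⟩ := exists_tailOperator (k := fun s => (s ^ 3)⁻¹) (c := fun _ => -1)
    (M := (2 * R ^ 2)⁻¹) hR0 (ContinuousOn.inv₀ (by fun_prop) fun s (hs : 0 < s) => by positivity)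
    (fun s hs => by positivity) (inv_pow_three_tail hR0).1 continuousOn_const (by positivity)
    (fun x hx => by
      have hx0 : 0 < x := hR0.trans_le hx
      rw [(inv_pow_three_tail hx0).2, abs_neg, abs_one, one_mul]
      gcongr)
  refine ⟨S, J, ?_, fun f r hr => ?_, fun f r => ?_⟩
  · refine (J.opNorm_comp_le S).trans ?_
    calc _ ≤ (2 * R ^ 2)⁻¹ * 4 := mul_le_mul hJ hS S.opNorm_nonneg (by positivity)
      _ = 2 / R ^ 2 := by field_simp; norm_num
  · rw [hSf, max_eq_left hr, gaussTail]
    ring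
  · rw [hJf, neg_one_mul]

end TailIntegrals

/-! ### The profile equation as an integral equation at infinity -/

section Profiles

open MeasureTheory

/-- `v` solves `v'' + (a/r - r/2) v' + h(v)/r² = 0` on `(R, ∞)`, with `v' = q`. -/
def ProfileSolves (a : ℝ) (h : ℝ → ℝ) (R : ℝ) (v q : ℝ → ℝ) : Prop :=
  ∀ r, R < r → HasDerivAt v (q r) r ∧ HasDerivAt q (-(a / r - r / 2) * q r - h (v r) / r ^ 2) r

/-- Continuous functions that stay close to a constant on `[R, ∞)`, extended constantly. -/
theorem exists_clampedExtension {v : ℝ → ℝ} {R ℓ η : ℝ} (hv : ContinuousOn v (Ici R))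
    (hη : ∀ r, R ≤ r → |v r - ℓ| ≤ η) :
    ∃ V : ℝ →ᵇ ℝ, (∀ r, V r = v (max r R)) ∧ ‖V - BoundedContinuousFunction.const ℝ ℓ‖ ≤ η := by
  have hη0 : 0 ≤ η := (abs_nonneg _).trans (hη R le_rfl)
  have hc : Continuous fun r => v (max r R) :=
    hv.comp_continuous (f := fun r => max r R) (by fun_prop) fun r => le_max_right r R
  refine ⟨BoundedContinuousFunction.ofNormedAddCommGroup _ hc (|ℓ| + η) fun r => ?_,
    fun r => rfl, ?_⟩
  · have h1 := hη (max r R) (le_max_right r R)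
    calc ‖v (max r R)‖ = |ℓ + (v (max r R) - ℓ)| := by rw [Real.norm_eq_abs]; congr 1; ring
      _ ≤ |ℓ| + |v (max r R) - ℓ| := abs_add_le _ _
      _ ≤ |ℓ| + η := by linarith
  · exact (BoundedContinuousFunction.norm_le hη0).2 fun r => hη (max r R) (le_max_right r R)

/-- By the integrating factor, `W q` minus the tail integral is a constant `c`. If `c ≠ 0`, then `c
/ W` is unbounded while the tail quotient is at most `4 ‖f‖`, so eventually `|q| > 1`. The mean
value theorem on `[s, s + 1]` then contradicts the convergence of `v`. -/
theorem ProfileSolves.eq_gaussTail_div {a R R₁ ℓ : ℝ} {h v q : ℝ → ℝ}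
    (hs : ProfileSolves a h R v q) (hlim : Tendsto v atTop (𝓝 ℓ)) (hR : R ≤ R₁)
    (hR₁ : tailRadius a ≤ R₁) {f : ℝ →ᵇ ℝ} (hf : ∀ r, R₁ < r → f r = h (v r)) {r : ℝ}
    (hr : R₁ < r) : q r = gaussTail a f r / gaussWeight a r := by
  have hpos : ∀ s, R₁ < s → 0 < s := fun s hs => by linarith [one_le_tailRadius a]
  have hD : ∀ s ∈ Ioi R₁,
      HasDerivAt (fun s => gaussWeight a s * q s - gaussTail a f s) 0 s := fun s hs' => by
    have hs0 := hpos s hs'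
    refine (((hasDerivAt_gaussWeight a hs0).mul (hs s (hR.trans_lt hs')).2).sub
      (hasDerivAt_gaussTail a f hs0)).congr_deriv ?_
    rw [hf s hs']
    field_simp
    ring
  obtain ⟨c, hc⟩ := isOpen_Ioi.exists_is_const_of_deriv_eq_zero isPreconnected_Ioi
    (fun s hs => (hD s hs).differentiableAt.differentiableWithinAt) (fun s hs => (hD s hs).deriv)
  have hq : ∀ s, R₁ < s → q s = c / gaussWeight a s + gaussTail a f s / gaussWeight a s :=
    fun s hs' => by
    have hw := gaussWeight_pos a (hpos s hs')
    have := hc s hs'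
    field_simp
    linarith
  rw [hq r hr]
  suffices c = 0 by rw [this, zero_div, zero_add]
  by_contra hc0
  have hcpos : 0 < |c| := abs_pos.2 hc0
  have e1 : ∀ᶠ s in atTop, gaussWeight a s < |c| / (4 * ‖f‖ + 1) :=
    (tendsto_gaussWeight a).eventually (Iio_mem_nhds (by positivity))
  have e2 : Tendsto (fun s => v (s + 1) - v s) atTop (𝓝 0) := by
    simpa using (hlim.comp (tendsto_atTop_add_const_right atTop 1 tendsto_id)).sub hlim
  have e3 : ∀ᶠ s in atTop, |v (s + 1) - v s| < 1 := by
    have := e2.eventually (Metric.ball_mem_nhds 0 one_pos)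
    simpa [Real.dist_eq] using this
  obtain ⟨s₁, hs₁⟩ := eventually_atTop.1 e1
  obtain ⟨s, hs1, hs2, hs3⟩ := (e3.and ((eventually_ge_atTop s₁).and (eventually_gt_atTop R₁))).exists
  obtain ⟨ξ, hξ, hξq⟩ := exists_hasDerivAt_eq_slope v q (lt_add_one s)
    (fun t ht => (hs t (hR.trans_lt (hs3.trans_le ht.1))).1.continuousAt.continuousWithinAt)
    (fun t ht => (hs t (hR.trans_lt (hs3.trans ht.1))).1)
  rw [add_sub_cancel_left, div_one] at hξq
  have hξ1 : R₁ < ξ := hs3.trans hξ.1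
  have hw := gaussWeight_pos a (hpos ξ hξ1)
  have h1 := hs₁ ξ (hs2.trans hξ.1.le)
  rw [lt_div_iff₀ (by positivity)] at h1
  have h2 : 4 * ‖f‖ + 1 < |c / gaussWeight a ξ| := by
    rw [abs_div, abs_of_pos hw, lt_div_iff₀ hw]; linarith
  have h3 : |gaussTail a f ξ / gaussWeight a ξ| ≤ 4 * ‖f‖ := by
    refine (abs_gaussTail_div_le a f (hR₁.trans hξ1.le)).trans ?_
    refine mul_le_of_le_one_right (by positivity) (inv_le_one_of_one_le₀ (one_le_pow₀ ?_))
    linarith [one_le_tailRadius a]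
  rw [← hξq, hq ξ hξ1] at hs1
  have h4 := abs_sub_abs_le_abs_sub (c / gaussWeight a ξ) (-(gaussTail a f ξ / gaussWeight a ξ))
  rw [abs_neg, sub_neg_eq_add] at h4
  linarith

theorem abs_integral_Ioi_le_of_le_inv_pow_three {q : ℝ → ℝ} {C r : ℝ} (hr : 0 < r)
    (hq : ∀ s, r < s → |q s| ≤ C * (s ^ 3)⁻¹) : |∫ s in Ioi r, q s| ≤ C * (2 * r ^ 2)⁻¹ := by
  rw [← (inv_pow_three_tail hr).2, ← integral_const_mul]
  refine norm_integral_le_of_norm_le (f := q) ((inv_pow_three_tail hr).1.const_mul C) ?_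
  filter_upwards [ae_restrict_mem measurableSet_Ioi] with s hs using hq s hs

theorem ProfileSolves.eq_sub_integral {a R R₁ ℓ : ℝ} {h v q : ℝ → ℝ}
    (hs : ProfileSolves a h R v q) (hlim : Tendsto v atTop (𝓝 ℓ)) (hR : R < R₁)
    (hR₁ : tailRadius a ≤ R₁) {f : ℝ →ᵇ ℝ} (hf : ∀ r, R₁ < r → f r = h (v r)) {r : ℝ}
    (hr : R₁ ≤ r) : v r = ℓ - ∫ s in Ioi r, q s := by
  have hr0 : 0 < r := by linarith [one_le_tailRadius a]
  have hint : IntegrableOn q (Ioi r) := by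
    refine Integrable.mono' ((inv_pow_three_tail hr0).1.const_mul (4 * ‖f‖)) ?_ ?_
    · refine ContinuousOn.aestronglyMeasurable (fun s hs' => ?_) measurableSet_Ioi
      exact (hs s ((hR.trans_le hr).trans hs')).2.continuousAt.continuousWithinAt
    · filter_upwards [ae_restrict_mem measurableSet_Ioi] with s hs'
      rw [hs.eq_gaussTail_div hlim hR.le hR₁ hf (hr.trans_lt hs')]
      exact abs_gaussTail_div_le a f (hR₁.trans (hr.trans (le_of_lt hs')))
  rw [integral_Ioi_of_hasDerivAt_of_tendsto' (fun s hs' =>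
    (hs s (hR.trans_le (hr.trans hs'))).1) hint hlim]
  ring

/-- Solutions with a limit at infinity are fixed points of the integral equation. -/
theorem ProfileSolves.eq_const_add {a R R₁ ℓ : ℝ} {h v q : ℝ → ℝ}
    (hs : ProfileSolves a h R v q) (hlim : Tendsto v atTop (𝓝 ℓ)) (hR : R < R₁)
    (hR₁ : tailRadius a ≤ R₁) {V F : ℝ →ᵇ ℝ} (hV : ∀ r, V r = v (max r R₁))
    (hF : ∀ r, F r = h (V r)) {S J : (ℝ →ᵇ ℝ) →L[ℝ] (ℝ →ᵇ ℝ)}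
    (hS : ∀ f r, R₁ ≤ r → S f r = r ^ 3 * (gaussTail a f r / gaussWeight a r))
    (hJ : ∀ f r, J f r = -∫ s in Ioi (max r R₁), (s ^ 3)⁻¹ * f s) :
    V = BoundedContinuousFunction.const ℝ ℓ + (J.comp S) F := by
  have hF' : ∀ r, R₁ < r → F r = h (v r) := fun r hr => by rw [hF, hV, max_eq_left hr.le]
  ext r
  have h1 : ∫ s in Ioi (max r R₁), (s ^ 3)⁻¹ * S F s = ∫ s in Ioi (max r R₁), q s := by
    refine setIntegral_congr_fun measurableSet_Ioi fun s hs' => ?_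
    have hs1 : R₁ < s := (le_max_right r R₁).trans_lt hs'
    have hs0 : 0 < s := by linarith [one_le_tailRadius a]
    rw [hS F s hs1.le, hs.eq_gaussTail_div hlim hR.le hR₁ hF' hs1,
      inv_mul_cancel_left₀ (by positivity)]
  simp only [BoundedContinuousFunction.coe_add, Pi.add_apply,
    BoundedContinuousFunction.const_apply', ContinuousLinearMap.comp_apply]
  rw [hV, hJ, h1, hs.eq_sub_integral hlim hR hR₁ hF' (le_max_right r R₁)]
  ring

/-- Fixed points of the integral equation are solutions with a limit at infinity. -/
theorem profileSolves_of_eq_const_add {a R ℓ : ℝ} {h : ℝ → ℝ} (hR : tailRadius a ≤ R)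
    {V F : ℝ →ᵇ ℝ} (hF : ∀ r, F r = h (V r)) {S J : (ℝ →ᵇ ℝ) →L[ℝ] (ℝ →ᵇ ℝ)}
    (hS : ∀ f r, R ≤ r → S f r = r ^ 3 * (gaussTail a f r / gaussWeight a r))
    (hJ : ∀ f r, J f r = -∫ s in Ioi (max r R), (s ^ 3)⁻¹ * f s)
    (hV : V = BoundedContinuousFunction.const ℝ ℓ + (J.comp S) F) :
    ProfileSolves a h R V (fun r => (r ^ 3)⁻¹ * S F r) := by
  intro r hr
  have hR0 : 0 < R := by linarith [one_le_tailRadius a]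
  have hr0 : 0 < r := hR0.trans hr
  have hVr : ∀ s, V s = ℓ + -∫ s in Ioi (max s R), (s ^ 3)⁻¹ * S F s := fun s => by
    rw [← hJ]
    exact congrArg (fun g : ℝ →ᵇ ℝ => g s) hV
  constructor
  · have h1 := ((hasDerivAt_integral_Ioi (k := fun s => (s ^ 3)⁻¹ * S F s) (c := R)
      ((ContinuousOn.inv₀ (by fun_prop) fun s (hs : 0 < s) => by positivity).mul
        (S F).continuous.continuousOn)
      (integrableOn_Ioi_mul_bounded (inv_pow_three_tail hR0).1 (S F)) hr0).neg).const_add ℓ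
    rw [neg_neg] at h1
    refine h1.congr_of_eventuallyEq ?_
    filter_upwards [Ioi_mem_nhds hr] with s hs
    rw [hVr, max_eq_left (le_of_lt hs)]
    rfl
  · have hq : (fun r => (r ^ 3)⁻¹ * S F r) =ᶠ[𝓝 r]
        fun r => gaussTail a F r / gaussWeight a r := by
      filter_upwards [Ioi_mem_nhds hr] with s hs
      have hs0 : 0 < s := hR0.trans hs
      rw [hS F s (le_of_lt hs), inv_mul_cancel_left₀ (by positivity)]
    have hw := gaussWeight_pos a hr0
    refine (((hasDerivAt_gaussTail a F hr0).div (hasDerivAt_gaussWeight a hr0)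
      hw.ne').congr_of_eventuallyEq hq).congr_deriv ?_
    have := hq.self_of_nhds
    simp only at this ⊢
    rw [this, ← hF]
    field_simp
    ring

theorem abs_profileOperator_le {R : ℝ} (hR : 0 < R) {J : (ℝ →ᵇ ℝ) →L[ℝ] (ℝ →ᵇ ℝ)}
    (hJ : ∀ f r, J f r = -∫ s in Ioi (max r R), (s ^ 3)⁻¹ * f s) (f : ℝ →ᵇ ℝ) {r : ℝ}
    (hr : R ≤ r) : |J f r| ≤ ‖f‖ * (2 * r ^ 2)⁻¹ := by
  rw [hJ, max_eq_left hr, abs_neg]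
  refine abs_integral_Ioi_le_of_le_inv_pow_three (hR.trans_le hr) fun s hs => ?_
  have hs0 : 0 < s := (hR.trans_le hr).trans hs
  rw [abs_mul, abs_of_pos (by positivity : (0 : ℝ) < (s ^ 3)⁻¹), mul_comm]
  exact mul_le_mul_of_nonneg_right (f.norm_coe_le_norm s) (by positivity)

theorem tendsto_profileOperator {R : ℝ} (hR : 0 < R) {J : (ℝ →ᵇ ℝ) →L[ℝ] (ℝ →ᵇ ℝ)}
    (hJ : ∀ f r, J f r = -∫ s in Ioi (max r R), (s ^ 3)⁻¹ * f s) (f : ℝ →ᵇ ℝ) :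
    Tendsto (J f) atTop (𝓝 0) := by
  have h1 : Tendsto (fun r : ℝ => ‖f‖ * (2 * r ^ 2)⁻¹) atTop (𝓝 0) := by
    have h2 : Tendsto (fun s : ℝ => 2 * s ^ 2) atTop atTop :=
      (tendsto_pow_atTop (by norm_num)).const_mul_atTop (by norm_num)
    have h3 := h2.inv_tendsto_atTop.const_mul ‖f‖
    rw [mul_zero] at h3
    exact h3
  refine squeeze_zero_norm' ?_ h1
  filter_upwards [eventually_ge_atTop R] with r hr using abs_profileOperator_le hR hJ f hr

/-- Solutions with a limit at infinity approach it at the rate `r⁻²`, their derivatives decay at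
the rate `r⁻³`. -/
theorem ProfileSolves.exists_bound {a R ℓ : ℝ} {h v q : ℝ → ℝ} (hs : ProfileSolves a h R v q)
    (hlim : Tendsto v atTop (𝓝 ℓ)) (hh : Continuous h) :
    ∃ C, ∀ᶠ r in atTop, |v r - ℓ| ≤ C * (r ^ 2)⁻¹ ∧ |q r| ≤ C * (r ^ 3)⁻¹ := by
  obtain ⟨M, hM⟩ := (isCompact_Icc (a := ℓ - 1) (b := ℓ + 1)).exists_bound_of_continuousOn
    hh.continuousOn
  obtain ⟨R₀, hR₀⟩ := eventually_atTop.1 (hlim.eventually (Metric.closedBall_mem_nhds ℓ one_pos))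
  set R₁ := max (max (R + 1) R₀) (tailRadius a)
  have hR : R < R₁ := (lt_add_one R).trans_le ((le_max_left _ _).trans (le_max_left _ _))
  have hR₁ : tailRadius a ≤ R₁ := le_max_right _ _
  have hv : ContinuousOn v (Ici R₁) := fun r hr =>
    (hs r (hR.trans_le hr)).1.continuousAt.continuousWithinAt
  obtain ⟨f, hf, -⟩ := exists_clampedExtension (v := fun r => h (v r)) (ℓ := 0) (η := M)
    (hh.comp_continuousOn hv) fun r hr => by
      rw [sub_zero]
      refine hM _ ?_
      have := hR₀ r (((le_max_right _ _).trans (le_max_left _ _)).trans hr)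
      rwa [← Metric.mem_closedBall, Real.closedBall_eq_Icc] at this
  have hf' : ∀ r, R₁ < r → f r = h (v r) := fun r hr => by rw [hf, max_eq_left hr.le]
  have hq : ∀ r, R₁ < r → |q r| ≤ 4 * ‖f‖ * (r ^ 3)⁻¹ := fun r hr => by
    rw [hs.eq_gaussTail_div hlim hR.le hR₁ hf' hr]
    exact abs_gaussTail_div_le a f (hR₁.trans hr.le)
  refine ⟨4 * ‖f‖, ?_⟩
  filter_upwards [eventually_gt_atTop R₁] with r hr
  have hr0 : 0 < r := by linarith [one_le_tailRadius a]
  refine ⟨?_, hq r hr⟩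
  rw [hs.eq_sub_integral hlim hR hR₁ hf' hr.le, sub_sub_cancel_left, abs_neg]
  refine (abs_integral_Ioi_le_of_le_inv_pow_three hr0 fun s hs' => hq s (hr.trans hs')).trans ?_
  refine mul_le_mul_of_nonneg_left ?_ (by positivity)
  rw [mul_inv]
  exact mul_le_of_le_one_left (by positivity) (by norm_num)

/-- Solutions are determined near infinity by their limit, where the nonlinearity is analytic. -/
theorem ProfileSolves.eventuallyEq {a R R' ℓ : ℝ} {h v q v' q' : ℝ → ℝ} (hh : AnalyticAt ℝ h ℓ)
    (hs : ProfileSolves a h R v q) (hs' : ProfileSolves a h R' v' q')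
    (hlim : Tendsto v atTop (𝓝 ℓ)) (hlim' : Tendsto v' atTop (𝓝 ℓ)) : v =ᶠ[atTop] v' := by
  obtain ⟨G, hG, hGh⟩ := hh.exists_superposition
  obtain ⟨V, ε, hε, hεU, δ, hδ, hV⟩ := hG.exists_fixedPoint_family hGh
  have e1 : ∀ᶠ r : ℝ in atTop, 2 / r ^ 2 < δ := by
    have : Tendsto (fun r : ℝ => 2 / r ^ 2) atTop (𝓝 0) :=
      tendsto_const_nhds.div_atTop (tendsto_pow_atTop (by norm_num))
    exact this.eventually (Iio_mem_nhds hδ)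
  have hball : Metric.closedBall ℓ (ε / 2) ∈ 𝓝 ℓ := Metric.closedBall_mem_nhds ℓ (by positivity)
  obtain ⟨R₀, hR₀⟩ := eventually_atTop.1
    ((hlim.eventually hball).and ((hlim'.eventually hball).and e1))
  set R₁ := max (max (R + 1) R₀) (max (R' + 1) (tailRadius a))
  have hR : R < R₁ := (lt_add_one R).trans_le ((le_max_left _ _).trans (le_max_left _ _))
  have hR' : R' < R₁ := (lt_add_one R').trans_le ((le_max_left _ _).trans (le_max_right _ _))
  have hR₁ : tailRadius a ≤ R₁ := (le_max_right _ _).trans (le_max_right _ _)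
  have hR₀₁ : R₀ ≤ R₁ := (le_max_right _ _).trans (le_max_left _ _)
  obtain ⟨S, J, hSJ, hS, hJ⟩ := exists_profileOperators a hR₁
  have hT : ‖J.comp S‖ < δ := hSJ.trans_lt (hR₀ R₁ hR₀₁).2.2
  -- Beyond `R₁` the operator is small and both solutions lie in the uniqueness ball, so each equals
  -- the one fixed point with constant term `ℓ`. The radius `ε / 2` turns the closed bound into
  -- membership in the open ball.
  have key : ∀ {R v q}, ProfileSolves a h R v q → Tendsto v atTop (𝓝 ℓ) → R < R₁ →
      (∀ r, R₀ ≤ r → v r ∈ Metric.closedBall ℓ (ε / 2)) → ∀ r, R₁ ≤ r →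
      v r = V (J.comp S, BoundedContinuousFunction.const ℝ ℓ) r := fun {R v q} hs hlim hR hb => by
    obtain ⟨W, hW, hWn⟩ := exists_clampedExtension (v := v) (R := R₁) (ℓ := ℓ) (η := ε / 2)
      (fun r hr => (hs r (hR.trans_le hr)).1.continuousAt.continuousWithinAt)
      (fun r hr => hb r (hR₀₁.trans hr))
    have hWb : W ∈ Metric.ball (BoundedContinuousFunction.const ℝ ℓ) ε := by
      rw [Metric.mem_ball, dist_eq_norm]; linarith
    have h1 := hs.eq_const_add hlim hR hR₁ hW (hεU hWb) hS hJ
    have h2 := (hV (J.comp S) (BoundedContinuousFunction.const ℝ ℓ) hT (by simpa using hδ)).2.2.2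
      W hWb h1
    intro r hr
    rw [h2, hW, max_eq_left hr]
  filter_upwards [eventually_ge_atTop R₁] with r hr
  rw [key hs hlim hR (fun r hr => (hR₀ r hr).1) r hr,
    key hs' hlim' hR' (fun r hr => (hR₀ r hr).2.1) r hr]

end Profiles

/-! ### Passage between the radial equation and the profile equation -/

/-- The nonlinearity in the equation for `v = r^{2/(p-1)} w`. -/
noncomputable def profileNonlinearity (N : ℕ) (p v : ℝ) : ℝ :=
  |v| ^ (p - 1) * v - 2 / (p - 1) * ((N : ℝ) - 2 - 2 / (p - 1)) * v

theorem continuous_profileNonlinearity (N : ℕ) {p : ℝ} (hp : 1 < p) :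
    Continuous (profileNonlinearity N p) := by
  unfold profileNonlinearity
  exact ((continuous_abs.rpow_const fun _ => Or.inr (by linarith)).mul continuous_id).sub
    (by fun_prop)

theorem analyticAt_profileNonlinearity (N : ℕ) (p : ℝ) {v : ℝ} (hv : 0 < v) :
    AnalyticAt ℝ (profileNonlinearity N p) v := by
  have h1 := (analyticAt_id (𝕜 := ℝ) (z := v)).div_const (c := p - 1)
  have h2 := (h1.sub (analyticAt_radialNonlinearity (p := p) hv)).sub
    ((analyticAt_const (v := 2 / (p - 1) * ((N : ℝ) - 2 - 2 / (p - 1)))).mul analyticAt_id)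
  refine h2.congr (Eventually.of_forall fun x => ?_)
  simp [profileNonlinearity]

theorem abs_rpow_mul_self_rescale {p r w : ℝ} (hp : 1 < p) (hr : 0 < r) :
    |r ^ (2 / (p - 1)) * w| ^ (p - 1) * (r ^ (2 / (p - 1)) * w) =
      r ^ 2 * r ^ (2 / (p - 1)) * (|w| ^ (p - 1) * w) := by
  have h1 : 0 < r ^ (2 / (p - 1)) := Real.rpow_pos_of_pos hr _
  have h2 : (r ^ (2 / (p - 1))) ^ (p - 1) = r ^ 2 := by
    rw [← Real.rpow_mul hr.le, div_mul_cancel₀ _ (by linarith), Real.rpow_two]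
  rw [abs_mul, abs_of_pos h1, Real.mul_rpow h1.le (abs_nonneg w), h2]
  ring

/-- With `w = r^(-m) v`, `m = 2/(p-1)`, the drift `-(r/2) w'` contributes `(m/2) w = w/(p-1)`, which
cancels the linear term of (1). Since `(r^m)^(p-1) = r²`, everything left of order zero carries the
factor `r⁻²`. -/
theorem SolvesOn.profileSolves {N : ℕ} {p R : ℝ} {w ψ : ℝ → ℝ} (hp : 1 < p) (hR : 0 ≤ R)
    (h : SolvesOn N p (Ioi R) w ψ) :
    ProfileSolves ((N : ℝ) - 1 - 2 * (2 / (p - 1))) (profileNonlinearity N p) R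
      (fun r => r ^ (2 / (p - 1)) * w r)
      (fun r => r ^ (2 / (p - 1)) * (ψ r + 2 / (p - 1) * w r / r)) := by
  intro r hr
  have hr0 : 0 < r := hR.trans_lt hr
  obtain ⟨h1, h2⟩ := h r hr
  have hpow : HasDerivAt (fun r : ℝ => r ^ (2 / (p - 1)))
      (2 / (p - 1) * (r ^ (2 / (p - 1)) / r)) r := by
    rw [← Real.rpow_sub_one hr0.ne']
    exact Real.hasDerivAt_rpow_const (Or.inl hr0.ne')
  have hp1 : p - 1 ≠ 0 := by linarith
  constructor
  · refine (hpow.mul h1).congr_deriv ?_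
    field_simp
    ring
  · refine (hpow.mul (h2.add ((h1.const_mul (2 / (p - 1))).div (hasDerivAt_id r)
      hr0.ne'))).congr_deriv ?_
    simp only [profileNonlinearity, radialRhs, abs_rpow_mul_self_rescale hp hr0, id]
    generalize |w r| ^ (p - 1) * w r = k
    generalize r ^ (2 / (p - 1)) = c
    simp only [Pi.add_apply, Pi.div_apply, id]
    field_simp
    ring

theorem ProfileSolves.solvesOn {N : ℕ} {p R : ℝ} {v q : ℝ → ℝ} (hp : 1 < p) (hR : 0 ≤ R)
    (h : ProfileSolves ((N : ℝ) - 1 - 2 * (2 / (p - 1))) (profileNonlinearity N p) R v q) :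
    SolvesOn N p (Ioi R) (fun r => r ^ (-(2 / (p - 1))) * v r)
      (fun r => r ^ (-(2 / (p - 1))) * (q r - 2 / (p - 1) * v r / r)) := by
  intro r hr
  have hr0 : 0 < r := hR.trans_lt hr
  obtain ⟨h1, h2⟩ := h r hr
  have hpow : HasDerivAt (fun r : ℝ => r ^ (-(2 / (p - 1))))
      (-(2 / (p - 1)) * (r ^ (-(2 / (p - 1))) / r)) r := by
    rw [← Real.rpow_sub_one hr0.ne']
    exact Real.hasDerivAt_rpow_const (Or.inl hr0.ne')
  have hp1 : p - 1 ≠ 0 := by linarith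
  constructor
  · refine (hpow.mul h1).congr_deriv ?_
    field_simp
    ring
  · refine (hpow.mul (h2.sub ((h1.const_mul (2 / (p - 1))).div (hasDerivAt_id r)
      hr0.ne'))).congr_deriv ?_
    have hc : r ^ (2 / (p - 1)) * r ^ (-(2 / (p - 1))) = 1 := by
      rw [← Real.rpow_add hr0, add_neg_cancel, Real.rpow_zero]
    have hk : |v r| ^ (p - 1) * v r = r ^ 2 * r ^ (2 / (p - 1)) *
        (|r ^ (-(2 / (p - 1))) * v r| ^ (p - 1) * (r ^ (-(2 / (p - 1))) * v r)) := by
      rw [← abs_rpow_mul_self_rescale hp hr0, ← mul_assoc (r ^ (2 / (p - 1))), hc, one_mul]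
    simp only [profileNonlinearity, radialRhs, id, hk]
    generalize |r ^ (-(2 / (p - 1))) * v r| ^ (p - 1) * (r ^ (-(2 / (p - 1))) * v r) = k
    have hc' : r ^ (2 / (p - 1)) = (r ^ (-(2 / (p - 1))))⁻¹ := eq_inv_of_mul_eq_one_left hc
    have hc0 : r ^ (-(2 / (p - 1))) ≠ 0 := (Real.rpow_pos_of_pos hr0 _).ne'
    rw [hc']
    generalize r ^ (-(2 / (p - 1))) = c at hc0
    simp only [Pi.sub_apply, Pi.div_apply, id]
    field_simp
    ring

/-- Solutions of the radial equation are determined by their leading coefficient at infinity. -/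
theorem SolvesOn.eq_of_tendsto {N : ℕ} {p R R' ℓ : ℝ} {w ψ w' ψ' : ℝ → ℝ} (hp : 1 < p)
    (hℓ : 0 < ℓ) (hR : 0 ≤ R) (hR' : 0 ≤ R') (h : SolvesOn N p (Ioi R) w ψ)
    (h' : SolvesOn N p (Ioi R') w' ψ')
    (hlim : Tendsto (fun r : ℝ => r ^ (2 / (p - 1)) * w r) atTop (𝓝 ℓ))
    (hlim' : Tendsto (fun r : ℝ => r ^ (2 / (p - 1)) * w' r) atTop (𝓝 ℓ)) {r : ℝ}
    (hr : R < r) (hr' : R' < r) : w r = w' r ∧ ψ r = ψ' r := by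
  have h1 := (h.profileSolves hp hR).eventuallyEq (analyticAt_profileNonlinearity N p hℓ)
    (h'.profileSolves hp hR') hlim hlim'
  obtain ⟨c, hc⟩ := eventually_atTop.1 h1
  set d := max c (max R R')
  have heq : ∀ s, d < s → w s = w' s := fun s hs => by
    have hs0 : 0 < s := hR.trans_lt (((le_max_left R R').trans (le_max_right c _)).trans_lt hs)
    exact mul_left_cancel₀ (Real.rpow_pos_of_pos hs0 _).ne' (hc s ((le_max_left c _).trans hs.le))
  have hd : d < d + 1 := lt_add_one d
  have hdR : R < d + 1 := ((le_max_left R R').trans (le_max_right c _)).trans_lt hd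
  have hdR' : R' < d + 1 := ((le_max_right R R').trans (le_max_right c _)).trans_lt hd
  -- Equality near infinity gives equal Cauchy data at one radius, from which initial value
  -- uniqueness propagates inwards.
  have hder : ψ (d + 1) = ψ' (d + 1) := by
    refine (h _ hdR).1.unique ((h' _ hdR').1.congr_of_eventuallyEq ?_)
    filter_upwards [Ioi_mem_nhds hd] with s hs using heq s hs
  exact SolvesOn.eqOn_Ioi hp (hR.trans (le_max_left R R'))
    (h.mono (Ioi_subset_Ioi (le_max_left _ _))) (h'.mono (Ioi_subset_Ioi (le_max_right _ _)))
    (max_lt hdR hdR') (heq _ hd) hder (max_lt hr hr')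

/-- For `v = r^m w` one has `v'/v = w'/w + m/r`, so both conditions follow from `v - ℓ = O(r⁻²)` and
`v' = O(r⁻³)`, each better by one power than required. -/
theorem SolvesOn.conditionsAtInfinity {N : ℕ} {p R ℓ : ℝ} {w ψ : ℝ → ℝ} (hp : 1 < p)
    (hℓ : 0 < ℓ) (hR : 0 ≤ R) (h : SolvesOn N p (Ioi R) w ψ)
    (hlim : Tendsto (fun r : ℝ => r ^ (2 / (p - 1)) * w r) atTop (𝓝 ℓ)) :
    ConditionsAtInfinity p ℓ w := by
  obtain ⟨C, hC⟩ := (h.profileSolves hp hR).exists_bound hlim (continuous_profileNonlinearity N hp)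
  have hv : ∀ᶠ r : ℝ in atTop, ℓ / 2 < r ^ (2 / (p - 1)) * w r :=
    hlim.eventually (Ioi_mem_nhds (by linarith))
  have hz : ∀ K : ℝ, Tendsto (fun r : ℝ => K * r⁻¹) atTop (𝓝 0) := fun K => by
    simpa using tendsto_inv_atTop_zero.const_mul K
  constructor
  · refine (isLittleO_iff_tendsto' ?_).2 (squeeze_zero_norm' ?_ (hz (C / ℓ)))
    · filter_upwards [eventually_gt_atTop 0] with r hr h0
      have := Real.rpow_pos_of_pos hr (-(2 / (p - 1)))
      have : 0 < ℓ * r ^ (-(2 / (p - 1))) * r⁻¹ := by positivity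
      exact absurd h0 this.ne'
    · filter_upwards [hC, eventually_gt_atTop 0] with r hCr hr
      have hc := Real.rpow_pos_of_pos hr (2 / (p - 1))
      have h1 := hCr.1
      rw [Real.rpow_neg hr.le]
      generalize r ^ (2 / (p - 1)) = c at *
      have h2 : (w r - ℓ * c⁻¹) / (ℓ * c⁻¹ * r⁻¹) = r / ℓ * (c * w r - ℓ) := by
        field_simp
      rw [h2, norm_mul, Real.norm_eq_abs, Real.norm_eq_abs, abs_of_pos (by positivity)]
      calc _ ≤ r / ℓ * (C * (r ^ 2)⁻¹) := mul_le_mul_of_nonneg_left h1 (by positivity)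
        _ = C / ℓ * r⁻¹ := by field_simp
  · refine (isLittleO_iff_tendsto' ?_).2 (squeeze_zero_norm' ?_ (hz (C / (ℓ / 2))))
    · filter_upwards [eventually_gt_atTop 0] with r hr h0
      have : 0 < (r ^ 2)⁻¹ := by positivity
      exact absurd h0 this.ne'
    · filter_upwards [hC, hv, eventually_gt_atTop R] with r hCr hvr hrR
      have hr : 0 < r := hR.trans_lt hrR
      have hc := Real.rpow_pos_of_pos hr (2 / (p - 1))
      have h1 := hCr.2
      rw [(h r hrR).1.deriv]
      generalize r ^ (2 / (p - 1)) = c at *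
      have hcw : 0 < c * w r := by linarith
      have hw : 0 < w r := pos_of_mul_pos_right hcw hc.le
      have h2 : (ψ r / w r - -(2 / (p - 1)) * r⁻¹) / (r ^ 2)⁻¹ =
          r ^ 2 * (c * (ψ r + 2 / (p - 1) * w r / r)) / (c * w r) := by
        have hp1 : p - 1 ≠ 0 := by linarith
        field_simp
        ring
      have hC0 : 0 ≤ C * (r ^ 3)⁻¹ := (abs_nonneg _).trans h1
      rw [h2, Real.norm_eq_abs, abs_div, abs_mul, abs_of_pos hcw,
        abs_of_pos (by positivity : 0 < r ^ 2)]
      calc _ ≤ r ^ 2 * (C * (r ^ 3)⁻¹) / (ℓ / 2) := by gcongr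
        _ = C / (ℓ / 2) * r⁻¹ := by field_simp

/-- Uniqueness in (i) uses (2) only through this limit. -/
theorem ConditionsAtInfinity.tendsto {p ℓ : ℝ} {w : ℝ → ℝ} (h : ConditionsAtInfinity p ℓ w) :
    Tendsto (fun r : ℝ => r ^ (2 / (p - 1)) * w r) atTop (𝓝 ℓ) := by
  have h1 : (fun r : ℝ => w r - ℓ * r ^ (-(2 / (p - 1)))) =o[atTop]
      fun r : ℝ => r ^ (-(2 / (p - 1))) := by
    refine h.1.trans_isBigO (IsBigO.of_bound |ℓ| ?_)
    filter_upwards [eventually_ge_atTop 1] with r hr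
    rw [norm_mul, norm_mul, Real.norm_eq_abs ℓ]
    refine mul_le_of_le_one_right (by positivity) ?_
    rw [Real.norm_of_nonneg (by positivity)]
    exact inv_le_one_of_one_le₀ hr
  have h2 := (h1.tendsto_div_nhds_zero).const_add ℓ
  rw [add_zero] at h2
  refine h2.congr' ?_
  filter_upwards [eventually_gt_atTop 0] with r hr
  have hc := Real.rpow_pos_of_pos hr (2 / (p - 1))
  rw [Real.rpow_neg hr.le]
  field_simp
  ring

/-! ### The analytic family near infinity -/

/-- Analytic family of solutions near infinity, parametrized by the leading coefficient. -/
theorem exists_solutionFamily_near_infinity (N : ℕ) {p ℓ₀ : ℝ} (hp : 1 < p) (hℓ₀ : 0 < ℓ₀) :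
    ∃ b > 0, ∃ θ > 0, ∃ U G, IsSolutionFamily N p b ℓ₀ θ U G ∧
      Tendsto (fun r : ℝ => r ^ (2 / (p - 1)) * deriv (U r) ℓ₀) atTop (𝓝 1) := by
  obtain ⟨G, hG, hGh⟩ := (analyticAt_profileNonlinearity N p hℓ₀).exists_superposition
  -- Intersecting with the ball of radius `ℓ₀` around the constant `ℓ₀` forces the profiles to be
  -- positive.
  obtain ⟨V, ε, hε, hεU, δ, hδ, hV⟩ := hG.exists_fixedPoint_family
    (Filter.inter_mem (hGh.and hG.eventually_analyticAt) (Metric.ball_mem_nhds _ hℓ₀))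
  set a := (N : ℝ) - 1 - 2 * (2 / (p - 1))
  obtain ⟨R, hRδ, hRa⟩ : ∃ R : ℝ, 2 / R ^ 2 < δ ∧ tailRadius a ≤ R := by
    have : Tendsto (fun r : ℝ => 2 / r ^ 2) atTop (𝓝 0) :=
      tendsto_const_nhds.div_atTop (tendsto_pow_atTop (by norm_num))
    exact ((this.eventually (Iio_mem_nhds hδ)).and (eventually_ge_atTop _)).exists
  have hR0 : 0 < R := by linarith [one_le_tailRadius a]
  obtain ⟨S, J, hSJ, hS, hJ⟩ := exists_profileOperators a hRa
  let v : ℝ → (ℝ →ᵇ ℝ) := fun ℓ => V (J.comp S, constCLM ℝ ℓ)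
  have hVℓ : ∀ ℓ ∈ Ioo (ℓ₀ - δ) (ℓ₀ + δ), AnalyticAt ℝ V (J.comp S, constCLM ℝ ℓ) ∧
      v ℓ ∈ Metric.ball (BoundedContinuousFunction.const ℝ ℓ₀) ε ∧
      v ℓ = constCLM ℝ ℓ + (J.comp S) (G (v ℓ)) := fun ℓ hℓ => by
    have h1 : ‖constCLM ℝ ℓ - BoundedContinuousFunction.const ℝ ℓ₀‖ < δ := by
      have : constCLM ℝ ℓ - BoundedContinuousFunction.const ℝ ℓ₀ = constCLM ℝ (ℓ - ℓ₀) := by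
        rw [map_sub]; rfl
      rw [this]
      refine (BoundedContinuousFunction.norm_const_le _).trans_lt ?_
      rw [Real.norm_eq_abs, abs_lt]
      constructor <;> linarith [hℓ.1, hℓ.2]
    obtain ⟨h2, h3, h4, -⟩ := hV (J.comp S) (constCLM ℝ ℓ) (hSJ.trans_lt hRδ) h1
    exact ⟨h2, h3, h4⟩
  have hvan : ∀ ℓ ∈ Ioo (ℓ₀ - δ) (ℓ₀ + δ), AnalyticAt ℝ v ℓ := fun ℓ hℓ =>
    (hVℓ ℓ hℓ).1.comp_of_eq (f := fun ℓ => (J.comp S, constCLM ℝ ℓ))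
      (analyticAt_const.prod ((constCLM ℝ).analyticAt ℓ)) rfl
  have hGvan : ∀ ℓ ∈ Ioo (ℓ₀ - δ) (ℓ₀ + δ), AnalyticAt ℝ (fun ℓ => G (v ℓ)) ℓ := fun ℓ hℓ =>
    (hεU (hVℓ ℓ hℓ).2.1).1.2.comp (hvan ℓ hℓ)
  have heval : ∀ (r : ℝ) {F : ℝ → (ℝ →ᵇ ℝ)} {ℓ : ℝ}, AnalyticAt ℝ F ℓ →
      AnalyticAt ℝ (fun ℓ => F ℓ r) ℓ := fun r F ℓ hF =>
    (ContinuousLinearMap.analyticAt (BoundedContinuousFunction.evalCLM ℝ r :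
      (ℝ →ᵇ ℝ) →L[ℝ] ℝ) _).comp hF
  have hlim : ∀ ℓ ∈ Ioo (ℓ₀ - δ) (ℓ₀ + δ), Tendsto (v ℓ) atTop (𝓝 ℓ) := fun ℓ hℓ => by
    have h1 := (tendsto_profileOperator hR0 hJ (S (G (v ℓ)))).const_add ℓ
    rw [add_zero] at h1
    refine h1.congr fun r => ?_
    exact (congrArg (fun g : ℝ →ᵇ ℝ => g r) (hVℓ ℓ hℓ).2.2).symm
  have hcancel : ∀ r : ℝ, 0 < r → ∀ x : ℝ, r ^ (2 / (p - 1)) * (r ^ (-(2 / (p - 1))) * x) = x :=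
    fun r hr x => by
    rw [← mul_assoc, ← Real.rpow_add hr, add_neg_cancel, Real.rpow_zero, one_mul]
  have hℓ₀mem : ℓ₀ ∈ Ioo (ℓ₀ - δ) (ℓ₀ + δ) := by constructor <;> linarith
  refine ⟨R, hR0, δ, hδ, fun r ℓ => r ^ (-(2 / (p - 1))) * v ℓ r,
    fun r ℓ => r ^ (-(2 / (p - 1))) * ((r ^ 3)⁻¹ * S (G (v ℓ)) r - 2 / (p - 1) * v ℓ r / r),
    ⟨fun ℓ hℓ => ?_, fun ℓ hℓ r hr => ?_, fun ℓ hℓ => ?_, fun ℓ hℓ r hr => ?_⟩, ?_⟩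
  · exact (profileSolves_of_eq_const_add hRa (hεU (hVℓ ℓ hℓ).2.1).1.1 hS hJ
      (hVℓ ℓ hℓ).2.2).solvesOn hp hR0.le
  · refine mul_pos (Real.rpow_pos_of_pos (hR0.trans hr) _) ?_
    have h1 := (hεU (hVℓ ℓ hℓ).2.1).2
    rw [Metric.mem_ball] at h1
    have h2 := (BoundedContinuousFunction.dist_coe_le_dist
      (f := v ℓ) (g := BoundedContinuousFunction.const ℝ ℓ₀) r).trans_lt h1
    rw [Real.dist_eq, BoundedContinuousFunction.const_apply', abs_lt] at h2
    linarith
  · refine (hlim ℓ hℓ).congr' ?_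
    filter_upwards [eventually_gt_atTop 0] with r hr
    rw [hcancel r hr]
  · exact ⟨analyticAt_const.mul (heval r (hvan ℓ hℓ)),
      analyticAt_const.mul ((analyticAt_const.mul (heval r ((S.analyticAt _).comp
        (hGvan ℓ hℓ)))).sub ((analyticAt_const.mul (heval r (hvan ℓ hℓ))).div_const))⟩
  -- Differentiating `v = ℓ + T(G v)` in the function space gives `v_ℓ = 1 + T(…)`, and every
  -- function in the range of `T` tends to `0` at infinity. No interchange of limits is needed.
  · have h1 : HasDerivAt v (constCLM ℝ 1 + (J.comp S) (deriv (fun ℓ => G (v ℓ)) ℓ₀)) ℓ₀ := by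
      have h2 : HasDerivAt (fun ℓ => constCLM ℝ ℓ + (J.comp S) (G (v ℓ)))
          (constCLM ℝ 1 + (J.comp S) (deriv (fun ℓ => G (v ℓ)) ℓ₀)) ℓ₀ :=
        ((constCLM ℝ).hasDerivAt).add
          ((J.comp S).hasFDerivAt.comp_hasDerivAt ℓ₀
            (hGvan ℓ₀ hℓ₀mem).differentiableAt.hasDerivAt)
      exact h2.congr_of_eventuallyEq
        (eventually_of_mem (isOpen_Ioo.mem_nhds hℓ₀mem) fun ℓ hℓ => (hVℓ ℓ hℓ).2.2)
    have h3 := (tendsto_profileOperator hR0 hJ (S (deriv (fun ℓ => G (v ℓ)) ℓ₀))).const_add 1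
    rw [add_zero] at h3
    refine h3.congr' ?_
    filter_upwards [eventually_gt_atTop 0] with r hr
    have h4 : HasDerivAt (fun ℓ => v ℓ r)
        ((constCLM ℝ 1 + (J.comp S) (deriv (fun ℓ => G (v ℓ)) ℓ₀)) r) ℓ₀ :=
      (BoundedContinuousFunction.evalCLM ℝ r :
        (ℝ →ᵇ ℝ) →L[ℝ] ℝ).hasFDerivAt.comp_hasDerivAt ℓ₀ h1
    rw [(h4.const_mul (r ^ (-(2 / (p - 1))))).deriv, hcancel r hr]
    rfl

/-! ### The parameter derivative and the linearized equation -/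

/-- Mixed partial derivatives of an analytic function of two variables commute. -/
theorem AnalyticAt.hasDerivAt_deriv_comm {F : ℝ × ℝ → ℝ} {r ℓ : ℝ}
    (hF : AnalyticAt ℝ F (r, ℓ)) :
    HasDerivAt (fun s => deriv (fun l => F (s, l)) ℓ)
      (deriv (fun l => deriv (fun s => F (s, l)) r) ℓ) r := by
  have hev := hF.eventually_analyticAt
  have hc1 : Tendsto (fun s : ℝ => (s, ℓ)) (𝓝 r) (𝓝 (r, ℓ)) := by
    have : Continuous fun s : ℝ => (s, ℓ) := by fun_prop
    exact this.tendsto r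
  have hc2 : Tendsto (fun l : ℝ => (r, l)) (𝓝 ℓ) (𝓝 (r, ℓ)) := by
    have : Continuous fun l : ℝ => (r, l) := by fun_prop
    exact this.tendsto ℓ
  have hd1 : ∀ x : ℝ × ℝ, HasDerivAt (fun s : ℝ => (s, x.2)) ((1 : ℝ), (0 : ℝ)) x.1 := fun x =>
    (hasDerivAt_id x.1).prodMk (hasDerivAt_const _ _)
  have hd2 : ∀ x : ℝ × ℝ, HasDerivAt (fun l : ℝ => (x.1, l)) ((0 : ℝ), (1 : ℝ)) x.2 := fun x =>
    (hasDerivAt_const _ _).prodMk (hasDerivAt_id x.2)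
  have hp1 : ∀ x : ℝ × ℝ, AnalyticAt ℝ F x →
      deriv (fun s => F (s, x.2)) x.1 = fderiv ℝ F x (1, 0) := fun x hx =>
    (hx.differentiableAt.hasFDerivAt.comp_hasDerivAt x.1 (hd1 x)).deriv
  have hp2 : ∀ x : ℝ × ℝ, AnalyticAt ℝ F x →
      deriv (fun l => F (x.1, l)) x.2 = fderiv ℝ F x (0, 1) := fun x hx =>
    (hx.differentiableAt.hasFDerivAt.comp_hasDerivAt x.2 (hd2 x)).deriv
  have hf' : HasFDerivAt (fderiv ℝ F) (fderiv ℝ (fderiv ℝ F) (r, ℓ)) (r, ℓ) :=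
    hF.fderiv.differentiableAt.hasFDerivAt
  have h1 : HasDerivAt (fun s => fderiv ℝ F (s, ℓ) (0, 1))
      (fderiv ℝ (fderiv ℝ F) (r, ℓ) (1, 0) (0, 1)) r :=
    (ContinuousLinearMap.apply ℝ ℝ ((0 : ℝ), (1 : ℝ))).hasFDerivAt.comp_hasDerivAt r
      (hf'.comp_hasDerivAt r (hd1 (r, ℓ)))
  have h2 : HasDerivAt (fun l => fderiv ℝ F (r, l) (1, 0))
      (fderiv ℝ (fderiv ℝ F) (r, ℓ) (0, 1) (1, 0)) ℓ :=
    (ContinuousLinearMap.apply ℝ ℝ ((1 : ℝ), (0 : ℝ))).hasFDerivAt.comp_hasDerivAt ℓ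
      (hf'.comp_hasDerivAt ℓ (hd2 (r, ℓ)))
  have hsymm : IsSymmSndFDerivAt ℝ F (r, ℓ) :=
    ContDiffAt.isSymmSndFDerivAt_of_omega hF.contDiffAt
  have h3 : deriv (fun l => deriv (fun s => F (s, l)) r) ℓ =
      fderiv ℝ (fderiv ℝ F) (r, ℓ) (1, 0) (0, 1) := by
    rw [hsymm.eq, ← h2.deriv]
    refine Filter.EventuallyEq.deriv_eq ?_
    filter_upwards [hc2.eventually hev] with l hl using hp1 (r, l) hl
  rw [h3]
  refine h1.congr_of_eventuallyEq ?_
  filter_upwards [hc1.eventually hev] with s hs using hp2 (s, ℓ) hs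

/-- The parameter derivative of a family of solutions solves the linearized equation. -/
theorem IsSolutionFamily.hasDerivAt_deriv {N : ℕ} {p b ℓ₀ θ : ℝ} {U G : ℝ → ℝ → ℝ}
    (h : IsSolutionFamily N p b ℓ₀ θ U G) (hp : 1 < p) (hb : 0 ≤ b) (hθ : 0 < θ) {r : ℝ}
    (hr : b < r) :
    HasDerivAt (fun s => deriv (U s) ℓ₀) (deriv (G r) ℓ₀) r ∧
      HasDerivAt (fun s => deriv (G s) ℓ₀) (-(((N : ℝ) - 1) / r - r / 2) * deriv (G r) ℓ₀ +
        deriv (U r) ℓ₀ / (p - 1) - p * U r ℓ₀ ^ (p - 1) * deriv (U r) ℓ₀) r := by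
  have hℓ₀ : ℓ₀ ∈ Ioo (ℓ₀ - θ) (ℓ₀ + θ) := by constructor <;> linarith
  have han := h.analyticAt_uncurry hp hb hr hℓ₀
  have hI : ∀ᶠ l in 𝓝 ℓ₀, l ∈ Ioo (ℓ₀ - θ) (ℓ₀ + θ) := isOpen_Ioo.mem_nhds hℓ₀
  obtain ⟨hU, hG⟩ := h.analyticAt ℓ₀ hℓ₀ r hr
  constructor
  · refine (AnalyticAt.hasDerivAt_deriv_comm (analyticAt_fst.comp han)).congr_deriv ?_
    refine Filter.EventuallyEq.deriv_eq ?_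
    filter_upwards [hI] with l hl using (h.solves l hl r hr).1.deriv
  · refine (AnalyticAt.hasDerivAt_deriv_comm (analyticAt_snd.comp han)).congr_deriv ?_
    have h1 : deriv (fun l => deriv (fun s => G s l) r) ℓ₀ =
        deriv (fun l => radialRhs N p r (U r l) (G r l)) ℓ₀ := by
      refine Filter.EventuallyEq.deriv_eq ?_
      filter_upwards [hI] with l hl using (h.solves l hl r hr).2.deriv
    refine h1.trans ?_
    have hUd := hU.differentiableAt.hasDerivAt
    have hGd := hG.differentiableAt.hasDerivAt
    have h2 := ((hGd.const_mul (-(((N : ℝ) - 1) / r - r / 2))).add (hUd.div_const (p - 1))).sub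
      ((hasDerivAt_abs_rpow_mul_self hp (U r ℓ₀)).comp ℓ₀ hUd)
    rw [abs_of_pos (h.pos ℓ₀ hℓ₀ r hr)] at h2
    exact h2.deriv

/-- Near `ℓ₀ > 0` all parameters are positive, so uniqueness at infinity makes the two families
coincide there. The derivative at `ℓ₀` hence does not depend on the family, and local versions of
`z` glue together. -/
theorem IsSolutionFamily.deriv_eq {N : ℕ} {p b b' ℓ₀ θ θ' : ℝ} {U G U' G' : ℝ → ℝ → ℝ}
    (h : IsSolutionFamily N p b ℓ₀ θ U G) (h' : IsSolutionFamily N p b' ℓ₀ θ' U' G') (hp : 1 < p)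
    (hℓ₀ : 0 < ℓ₀) (hb : 0 ≤ b) (hb' : 0 ≤ b') (hθ : 0 < θ) (hθ' : 0 < θ') {r : ℝ} (hr : b < r)
    (hr' : b' < r) : deriv (U r) ℓ₀ = deriv (U' r) ℓ₀ ∧ deriv (G r) ℓ₀ = deriv (G' r) ℓ₀ := by
  have hev : ∀ᶠ l in 𝓝 ℓ₀, U r l = U' r l ∧ G r l = G' r l := by
    filter_upwards [Ioo_mem_nhds (by linarith : ℓ₀ - θ < ℓ₀) (by linarith : ℓ₀ < ℓ₀ + θ),
      Ioo_mem_nhds (by linarith : ℓ₀ - θ' < ℓ₀) (by linarith : ℓ₀ < ℓ₀ + θ'),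
      Ioi_mem_nhds hℓ₀] with l hl hl' hl0
    exact SolvesOn.eq_of_tendsto hp hl0 hb hb' (h.solves l hl) (h'.solves l hl')
      (h.tendsto l hl) (h'.tendsto l hl') hr hr'
  exact ⟨Filter.EventuallyEq.deriv_eq (hev.mono fun _ h => h.1),
    Filter.EventuallyEq.deriv_eq (hev.mono fun _ h => h.2)⟩

/-- Analytic families through a global positive solution `φ` with leading coefficient `ℓ₀`. -/
theorem exists_analytic_family {N : ℕ} {p ℓ₀ : ℝ} (hp : 1 < p) (hℓ₀ : 0 < ℓ₀) {φ ψ : ℝ → ℝ}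
    (hφ : SolvesOn N p (Ioi 0) φ ψ) (hφpos : ∀ r, 0 < r → 0 < φ r)
    (hφlim : Tendsto (fun r : ℝ => r ^ (2 / (p - 1)) * φ r) atTop (𝓝 ℓ₀)) {r₀ : ℝ}
    (hr₀ : 0 < r₀) :
    ∃ θ : ℝ, 0 < θ ∧ ∃ u : ℝ → ℝ → ℝ,
      AnalyticOnNhd ℝ (fun x : ℝ × ℝ => u x.1 x.2)
        (Ioi (r₀ / 2) ×ˢ Ioo (ℓ₀ - θ) (ℓ₀ + θ)) ∧
      (∀ ℓ ∈ Ioo (ℓ₀ - θ) (ℓ₀ + θ),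
        (∀ r ∈ Ici (r₀ / 2), 0 < u r ℓ) ∧
        IsSolutionOn N p (Ici (r₀ / 2)) (fun r => u r ℓ) ∧
        ConditionsAtInfinity p ℓ (fun r => u r ℓ) ∧
        ∀ R : ℝ, 0 ≤ R → ∀ w : ℝ → ℝ, IsSolutionOn N p (Ioi R) w →
          ConditionsAtInfinity p ℓ w →
          EqOn w (fun r => u r ℓ) (Ioi R ∩ Ici (r₀ / 2))) ∧
      ∃ z : ℝ → ℝ,
        (∀ r ∈ Ioi (r₀ / 2), z r = deriv (fun ℓ => u r ℓ) ℓ₀) ∧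
        (∀ φ', EqOn φ' φ (Ioi 0) → IsLinearizedSolution N p φ' z) ∧
        Tendsto (fun r : ℝ => r ^ (2 / (p - 1)) * z r) atTop (𝓝 1) := by
  obtain ⟨b₁, hb₁, θ₁, hθ₁, U₁, G₁, hfam₁, hlim₁⟩ :=
    exists_solutionFamily_near_infinity N hp hℓ₀
  have hmem : ∀ {θ : ℝ}, 0 < θ → ℓ₀ ∈ Ioo (ℓ₀ - θ) (ℓ₀ + θ) := fun hθ => by
    constructor <;> linarith
  have huniq : ∀ b θ U G, 0 ≤ b → 0 < θ → IsSolutionFamily N p b ℓ₀ θ U G →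
      ∀ r, b < r → U r ℓ₀ = φ r ∧ G r ℓ₀ = ψ r := fun b θ U G hb hθ hfam r hr =>
    SolvesOn.eq_of_tendsto hp hℓ₀ hb le_rfl (hfam.solves ℓ₀ (hmem hθ)) hφ
      (hfam.tendsto ℓ₀ (hmem hθ)) hφlim hr (hb.trans_lt hr)
  have hall : ∀ b : ℝ, 0 < b → ∃ θ > 0, ∃ U G, IsSolutionFamily N p b ℓ₀ θ U G := fun b hb =>
    IsSolutionFamily.exists_of_global hp hφ hφpos huniq ⟨b₁, hb₁, θ₁, hθ₁, U₁, G₁, hfam₁⟩ hb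
  choose! θ hθ U G hfam using hall
  -- No single family need reach `r = 0`, since `θ` may shrink with `b`. At each `r` the family on
  -- `(r/2, ∞)` is used; `hzy` replaces it by any other.
  set z : ℝ → ℝ := fun r => deriv (U (r / 2) r) ℓ₀ with hz
  set y : ℝ → ℝ := fun r => deriv (G (r / 2) r) ℓ₀ with hy
  have hzy : ∀ {b θ' U' G'}, 0 ≤ b → 0 < θ' → IsSolutionFamily N p b ℓ₀ θ' U' G' → ∀ r, b < r →
      z r = deriv (U' r) ℓ₀ ∧ y r = deriv (G' r) ℓ₀ := fun {b θ' U' G'} hb hθ' hfam' r hr => by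
    have hr0 : 0 < r / 2 := by linarith
    exact (hfam _ hr0).deriv_eq hfam' hp hℓ₀ hr0.le hb (hθ _ hr0) hθ' (by linarith) hr
  have hder : ∀ r ∈ Ioi (0 : ℝ), HasDerivAt z (y r) r ∧
      HasDerivAt y (-(((N : ℝ) - 1) / r - r / 2) * y r + z r / (p - 1) -
        p * φ r ^ (p - 1) * z r) r := fun r hr => by
    have hr0 : 0 < r / 2 := half_pos hr
    have hr2 : r / 2 < r := half_lt_self hr
    have hf := hfam _ hr0
    obtain ⟨h1, h2⟩ := hf.hasDerivAt_deriv hp hr0.le (hθ _ hr0) hr2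
    rw [(huniq _ _ _ _ hr0.le (hθ _ hr0) hf r hr2).1] at h2
    exact ⟨h1.congr_of_eventuallyEq (eventually_of_mem (Ioi_mem_nhds hr2) fun s hs =>
        (hzy hr0.le (hθ _ hr0) hf s hs).1),
      h2.congr_of_eventuallyEq (eventually_of_mem (Ioi_mem_nhds hr2) fun s hs =>
        (hzy hr0.le (hθ _ hr0) hf s hs).2)⟩
  have hb : 0 < r₀ / 4 := by linarith
  have hbr : r₀ / 4 < r₀ / 2 := by linarith
  -- Starting at `r₀ / 4` makes the endpoint `r₀ / 2` an interior point, and `θ ≤ ℓ₀` keeps every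
  -- `ℓ` positive, as uniqueness requires.
  have hfam₀ := (hfam (r₀ / 4) hb).mono le_rfl (min_le_left (θ (r₀ / 4)) ℓ₀)
  have hθ₀ : 0 < min (θ (r₀ / 4)) ℓ₀ := lt_min (hθ _ hb) hℓ₀
  have hℓpos : ∀ ℓ ∈ Ioo (ℓ₀ - min (θ (r₀ / 4)) ℓ₀) (ℓ₀ + min (θ (r₀ / 4)) ℓ₀), 0 < ℓ :=
    fun ℓ hℓ => by linarith [hℓ.1, min_le_right (θ (r₀ / 4)) ℓ₀]
  refine ⟨_, hθ₀, U (r₀ / 4), fun x hx => ?_, fun ℓ hℓ => ⟨fun r hr => ?_, ?_, ?_, ?_⟩,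
    z, fun r hr => ?_, fun φ' hφ' => ?_, ?_⟩
  · exact analyticAt_fst.comp (hfam₀.analyticAt_uncurry hp hb.le (hbr.trans hx.1) hx.2)
  · exact hfam₀.pos ℓ hℓ r (hbr.trans_le hr)
  · exact ((hfam₀.solves ℓ hℓ).mono fun r hr => hbr.trans_le hr).isSolutionOn hp
      (uniqueDiffOn_Ici _) fun r hr => hb.trans (hbr.trans_le hr)
  · exact (hfam₀.solves ℓ hℓ).conditionsAtInfinity hp (hℓpos ℓ hℓ) hb.le (hfam₀.tendsto ℓ hℓ)
  · intro R hR w hw hcond r hr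
    exact (SolvesOn.eq_of_tendsto hp (hℓpos ℓ hℓ) hR hb.le hw.solvesOn (hfam₀.solves ℓ hℓ)
      hcond.tendsto (hfam₀.tendsto ℓ hℓ) hr.1 (hbr.trans_le hr.2)).1
  · exact (hzy hb.le hθ₀ hfam₀ r (hbr.trans hr)).1
  · have hzc : ContinuousOn z (Ioi 0) := fun r hr =>
      (hder r hr).1.continuousAt.continuousWithinAt
    have hyc : ContinuousOn y (Ioi 0) := fun r hr =>
      (hder r hr).2.continuousAt.continuousWithinAt
    have hφc : ContinuousOn φ (Ioi 0) := fun r hr =>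
      (hφ r hr).1.continuousAt.continuousWithinAt
    refine ⟨contDiffOn_two_of_hasDerivAt isOpen_Ioi.uniqueDiffOn (fun r hr => (hder r hr).1)
      (fun r hr => (hder r hr).2) ?_, fun r hr => ?_⟩
    · exact (((ContinuousOn.neg ((continuousOn_const.div continuousOn_id
        fun r hr => ne_of_gt hr).sub (by fun_prop))).mul hyc).add (hzc.div_const _)).sub
        ((continuousOn_const.mul (hφc.rpow_const fun r hr => Or.inl (hφpos r hr).ne')).mul hzc)
    · rw [radialOp_eq_of_hasDerivAt isOpen_Ioi.uniqueDiffOn (fun r hr => (hder r hr).1) hr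
        (hder r hr).2, hφ' hr]
      ring
  · refine hlim₁.congr' ?_
    filter_upwards [eventually_gt_atTop b₁] with r hr
    rw [(hzy hb₁.le hθ₁ hfam₁ r hr).1]

/-! ### The singular solution and the conclusion -/

/-- `L` is defined so that `L^(p-1) = m(N - 2 - m)` with `m = 2/(p-1)`. The singular solution thus
corresponds to a constant profile. -/
theorem profileNonlinearity_Lconst {N : ℕ} {p : ℝ} (hp : 1 < p) (hN : 0 ≤ ((N : ℝ) - 2) * p - N) :
    profileNonlinearity N p (Lconst N p) = 0 := by
  have hp1 : p - 1 ≠ 0 := by linarith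
  have hp0 : 0 < p - 1 := by linarith
  have hL : 0 ≤ Lconst N p := Real.rpow_nonneg (by positivity) _
  have h1 : Lconst N p ^ (p - 1) = 2 / (p - 1) ^ 2 * (((N : ℝ) - 2) * p - N) := by
    rw [Lconst, ← Real.rpow_mul (by positivity), one_div_mul_cancel hp1, Real.rpow_one]
  rw [profileNonlinearity, abs_of_nonneg hL, h1]
  field_simp
  ring

theorem exists_solvesOn_phiInfty {N : ℕ} {p : ℝ} (hp : 1 < p)
    (hN : 0 ≤ ((N : ℝ) - 2) * p - N) : ∃ ψ, SolvesOn N p (Ioi 0) (phiInfty N p) ψ := by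
  have h : ProfileSolves ((N : ℝ) - 1 - 2 * (2 / (p - 1))) (profileNonlinearity N p) 0
      (fun _ => Lconst N p) fun _ => 0 := fun r _ => by
    refine ⟨hasDerivAt_const r _, (hasDerivAt_const r (0 : ℝ)).congr_deriv ?_⟩
    rw [profileNonlinearity_Lconst hp hN]
    ring
  exact ⟨_, (h.solvesOn hp le_rfl).congr isOpen_Ioi (fun r _ => mul_comm _ _) fun r _ => rfl⟩

theorem tendsto_phiInfty (N : ℕ) (p : ℝ) :
    Tendsto (fun r : ℝ => r ^ (2 / (p - 1)) * phiInfty N p r) atTop (𝓝 (Lconst N p)) := by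
  refine tendsto_const_nhds.congr' ?_
  filter_upwards [eventually_gt_atTop 0] with r hr
  rw [phiInfty, mul_left_comm, ← Real.rpow_add hr, add_neg_cancel, Real.rpow_zero, mul_one]

/-- For `N ≤ 2` the hypothesis is void. Of supercriticality only `p > 1` and `(N-2)p > N`, that is
`L > 0`, enter the proof. -/
theorem supercritical_of_pS_lt {N : ℕ} {p : ℝ} (hp : pS N < (p : EReal)) :
    1 < p ∧ 0 < ((N : ℝ) - 2) * p - N := by
  unfold pS at hp
  split_ifs at hp with hN
  · have hN' : (2 : ℝ) < N := by exact_mod_cast hN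
    have h1 : ((N : ℝ) + 2) / ((N : ℝ) - 2) < p := EReal.coe_lt_coe_iff.1 hp
    rw [div_lt_iff₀ (by linarith)] at h1
    constructor
    · by_contra! hle
      nlinarith
    · linarith
  · exact absurd hp not_top_lt

theorem lemma3p2 (N : ℕ) (p : ℝ) (hp : pS N < (p : EReal))
    (ℓ₀ : ℝ) (hℓ₀ : ℓ₀ ∈ admissibleSet N p) (r₀ : ℝ) (hr₀ : 0 < r₀) :
    ∃ θ : ℝ, 0 < θ ∧ ∃ u : ℝ → ℝ → ℝ,
      -- `u` is jointly analytic
      AnalyticOnNhd ℝ (fun x : ℝ × ℝ => u x.1 x.2)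
        (Ioi (r₀ / 2) ×ˢ Ioo (ℓ₀ - θ) (ℓ₀ + θ)) ∧
      -- (i) positive solution with the conditions at infinity, and uniqueness
      (∀ ℓ ∈ Ioo (ℓ₀ - θ) (ℓ₀ + θ),
        (∀ r ∈ Ici (r₀ / 2), 0 < u r ℓ) ∧
        IsSolutionOn N p (Ici (r₀ / 2)) (fun r => u r ℓ) ∧
        ConditionsAtInfinity p ℓ (fun r => u r ℓ) ∧
        ∀ R : ℝ, 0 ≤ R → ∀ w : ℝ → ℝ, IsSolutionOn N p (Ioi R) w →
          ConditionsAtInfinity p ℓ w →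
          EqOn w (fun r => u r ℓ) (Ioi R ∩ Ici (r₀ / 2))) ∧
      -- (ii) the derivative with respect to `ℓ` at `ℓ₀`
      (∃ z : ℝ → ℝ,
        (∀ r ∈ Ioi (r₀ / 2), z r = deriv (fun ℓ => u r ℓ) ℓ₀) ∧
        (∀ α₀ ∈ regularSet N p \ {kappa p}, ∀ w : ℝ → ℝ,
          IsPositiveRegularSolution N p α₀ w → HasLeadingCoeff p w ℓ₀ →
          IsLinearizedSolution N p w z) ∧
        (ℓ₀ = Lconst N p → IsLinearizedSolution N p (phiInfty N p) z) ∧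
        Tendsto (fun r : ℝ => r ^ (2 / (p - 1)) * z r) atTop (𝓝 1)) := by
  obtain ⟨hp1, hN⟩ := supercritical_of_pS_lt hp
  have hp0 : 0 < p - 1 := by linarith
  have hL : 0 < Lconst N p := Real.rpow_pos_of_pos (by positivity) _
  obtain ⟨ψL, hψL⟩ := exists_solvesOn_phiInfty hp1 hN.le
  obtain ⟨hpos, φ, ψ, hφ, hφpos, hφlim⟩ : 0 < ℓ₀ ∧ ∃ φ ψ : ℝ → ℝ, SolvesOn N p (Ioi 0) φ ψ ∧
      (∀ r, 0 < r → 0 < φ r) ∧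
      Tendsto (fun r : ℝ => r ^ (2 / (p - 1)) * φ r) atTop (𝓝 ℓ₀) := by
    rcases hℓ₀ with rfl | ⟨α, -, w, hw, hwℓ⟩
    · exact ⟨hL, _, _, hψL, fun r hr => mul_pos hL (Real.rpow_pos_of_pos hr _),
        tendsto_phiInfty N p⟩
    · exact ⟨hwℓ.1, w, _, hw.solution.solvesOn, hw.pos, hwℓ.2⟩
  -- The same `ℓ₀` might come from several `α₀`, or from `L` as well. All solutions on `(0,∞)` with
  -- this coefficient coincide, so one `φ` serves every case of (ii).
  have huniq : ∀ {φ' ψ' : ℝ → ℝ}, SolvesOn N p (Ioi 0) φ' ψ' →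
      Tendsto (fun r : ℝ => r ^ (2 / (p - 1)) * φ' r) atTop (𝓝 ℓ₀) → EqOn φ' φ (Ioi 0) :=
    fun h hlim r hr =>
      (SolvesOn.eq_of_tendsto hp1 hpos le_rfl le_rfl h hφ hlim hφlim hr hr).1
  obtain ⟨θ, hθ, u, hu, hi, z, hz, hzlin, hzlim⟩ :=
    exists_analytic_family hp1 hpos hφ hφpos hφlim hr₀
  refine ⟨θ, hθ, u, hu, hi, z, hz, fun α₀ _ w hw hwℓ => ?_, fun h => ?_, hzlim⟩
  · exact hzlin w (huniq hw.solution.solvesOn hwℓ.2)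
  · exact hzlin _ (huniq hψL (h ▸ tendsto_phiInfty N p))
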